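/- Let $m\ge 2$ and $d\ge 3$ be integers and let $K$ be an infinite field whose characteristic is $0$ or greater than $d$. Let $S=K_{\mathrm{DP}}[X_0,\dots,X_n,Y_1,\dots,Y_m]$ be the divided power algebra, on which $R=K[x_0,\dots,x_n,y_1,\dots,y_m]$ acts by contraction. Let $F=X_0P_0+\dots+X_nP_n+G\in S_d$, where $P_0,\dots,P_n$ is a basis of $K_{\mathrm{DP}}[Y_1,\dots,Y_m]_{d-1}$ and $G\in K_{\mathrm{DP}}[Y_1,\dots,Y_m]_d$, and let $A_F=R/\operatorname{Ann}_R(F)$ be the corresponding full Perazzo algebra (for instance $F=\sum_{i_1+\dots+i_m=d-1}X_{i_1,\dots,i_m}Y_1^{i_1}\cdots Y_m^{i_m}$). Put $N=\dim_K A_F$, and for a linear form $\ell$ let $P_{\ell,A_F}$ denote its Jordan type, i.e. the partition of $N$ given by the sizes of the Jordan blocks of multiplication by $\ell$ on $A_F$. Set $a_{\min}=d$ and $$a_{\max}=\begin{cases}\binom{\frac{d-1}{2}+m-1}{m-1}+2\sum_{i=0}^{\frac{d-3}{2}}\binom{i+m-1}{m-1}&\text{if } d \text{ is odd},\\[4pt]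 2\sum_{i=0}^{\frac{d-2}{2}}\binom{i+m-1}{m-1}&\text{if } d\text{ is even},\end{cases}$$ which is the dimension of a compressed Gorenstein algebra of codimension $m$ and socle degree $d-1$, and set $b_{\max}=N-2a_{\min}$ and $b_{\min}=N-2a_{\max}$. Let $$T_{1}=\bigl(d^2,(d-1)^{2\binom{m-1}{m-2}},(d-2)^{2\binom{m}{m-2}},\dots,1^{2\binom{m+d-3}{m-2}}\bigr),$$ $$T_{2}=\bigl(d+1,(d-1)^{2m-1},(d-2)^{2\binom{m}{m-2}},\dots,1^{2\binom{m+d-3}{m-2}}\bigr).$$ Then the Jordan types of all nonzero linear forms $\ell=\sum_i a_ix_i+\sum_j b_jy_j$ lie in the following chain, which is strictly increasing for the dominance order: $$(2^{a_{\min}},1^{b_{\max}})<\cdots<(2^{a_{\max}},1^{b_{\min}})<T_1<T_2,$$ where the dots stand for the partitions $(2^a,1^{N-2a})$ with $a_{\min}<a<a_{\max}$ in increasing order of $a$. More precisely: 1. $2a_{\max}\le N$ and $a_{\min}<a_{\max}$. 2. If all $b_j$ are $0$ and $\ell\neq 0$, then $P_{\ell,A_F}=(2^a,1^{N-2a})$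 with $a=\dim_K R/\operatorname{Ann}_R(\ell\circ F)$ and $a_{\min}\le a\le a_{\max}$. Both $a=a_{\min}$ and $a=a_{\max}$ occur for such $\ell$. 3. If some $b_j$ is nonzero, then $P_{\ell,A_F}$ is $T_1$ or $T_2$. Both occur for such $\ell$. -/

import Mathlib

noncomputable section

namespace FullPerazzo

open MvPolynomial

/-- The divided power ring `K_DP[Z_s : s ∈ σ]`, regarded as a `K`-vector space: the free vector
space on the divided power monomials `Z^[α]`, where `α : σ →₀ ℕ` is the vector of exponents.
(Of its multiplication, only the products of a variable with polynomials in other variables are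
needed below, see `varMul`.) -/
abbrev DP (K : Type*) [Field K] (σ : Type*) : Type _ := (σ →₀ ℕ) →₀ K

/-- The homogeneous elements of degree `n`. -/
def DP.homogeneous (K : Type*) [Field K] (σ : Type*) (n : ℕ) : Submodule K (DP K σ) :=
  Finsupp.supported K K {α : σ →₀ ℕ | α.degree = n}

/-- Contraction by the monomial `z^α`: it sends `Z^[γ + α]` to `Z^[γ]`, and it sends `Z^[β]` to `0`
if `β` is not of the form `γ + α`; so the coefficient of `Z^[γ]` in the image of `F` is the
coefficient of `Z^[γ + α]` in `F`. -/
def contractMonomial (K : Type*) [Field K] {σ : Type*} (α : σ →₀ ℕ) : DP K σ →ₗ[K] DP K σ :=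
  Finsupp.lcomapDomain (fun γ : σ →₀ ℕ => γ + α) (add_left_injective α)

theorem contractMonomial_apply (K : Type*) [Field K] {σ : Type*} (α γ : σ →₀ ℕ) (F : DP K σ) :
    contractMonomial K α F γ = F (γ + α) := rfl

/-- The contraction action of the polynomial ring `K[z_s : s ∈ σ]` on `K_DP[Z_s : s ∈ σ]`. -/
def contraction (K : Type*) [Field K] (σ : Type*) :
    MvPolynomial σ K →ₐ[K] Module.End K (DP K σ) :=
  AddMonoidAlgebra.lift K (Module.End K (DP K σ)) (σ →₀ ℕ)
    { toFun := fun α => contractMonomial K α.toAdd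
      map_one' := by
        ext1 β
        apply LinearMap.ext
        intro c
        apply Finsupp.ext
        intro γ
        simp [contractMonomial_apply]
      map_mul' := fun α β => by
        apply LinearMap.ext
        intro F
        apply Finsupp.ext
        intro γ
        simp [contractMonomial_apply, add_assoc, add_comm α.toAdd] }

/-- The annihilator `Ann F = {f | f ∘ F = 0}` in the polynomial ring. -/
def Ann {K : Type*} [Field K] {σ : Type*} (F : DP K σ) : Ideal (MvPolynomial σ K) where
  carrier := {f | contraction K σ f F = 0}
  zero_mem' := by simp
  add_mem' := fun {f g} hf hg => by
    simp only [Set.mem_ofPred_eq] at hf hg ⊢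
    simp [hf, hg]
  smul_mem' := fun r f hf => by
    simp only [Set.mem_ofPred_eq] at hf ⊢
    simp [hf]

/-- The algebra `A_F = K[z] / Ann F` with Macaulay dual generator `F`. -/
abbrev Alg {K : Type*} [Field K] {σ : Type*} (F : DP K σ) : Type _ :=
  MvPolynomial σ K ⧸ Ann F

/-- The inclusion `K_DP[Y_1, …, Y_m] → K_DP[X_i, Y_1, …, Y_m]`. The variables `X_i` are
indexed by `Sum.inl i`, the variables `Y_j` by `Sum.inr j`. -/
def inclY {K : Type*} [Field K] (ι : Type*) {m : ℕ} (G : DP K (Fin m)) :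
    DP K (ι ⊕ Fin m) :=
  Finsupp.mapDomain (fun α : Fin m →₀ ℕ => α.mapDomain Sum.inr) G

/-- The product `X_i * P` for `P ∈ K_DP[Y_1, …, Y_m]`. As `X_i` does not occur in `P`,
each product `X_i * Y^[α]` is again a divided power monomial. -/
def varMul {K : Type*} [Field K] {ι : Type*} {m : ℕ} (i : ι) (P : DP K (Fin m)) :
    DP K (ι ⊕ Fin m) :=
  Finsupp.mapDomain
    (fun α : Fin m →₀ ℕ => Finsupp.single (Sum.inl i) 1 + α.mapDomain Sum.inr) P

/-- The form `F = ∑ X_i P_i + G`. -/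
def perazzoForm {K : Type*} [Field K] {ι : Type*} [Fintype ι] {m : ℕ}
    (P : ι → DP K (Fin m)) (G : DP K (Fin m)) : DP K (ι ⊕ Fin m) :=
  ∑ i, varMul i (P i) + inclY ι G

/-- The data of a full Perazzo form `∑ X_i P_i + G` of degree `d`: the `P_i` form a basis of the
forms of degree `d - 1` in `Y_1, …, Y_m`, and `G` is a form of degree `d` in `Y_1, …, Y_m`.
(For `m ≥ 2` and `d ≥ 3` there are more than `m` forms `P_i`, so that they are automatically
algebraically dependent.) -/
structure IsFullPerazzo {K : Type*} [Field K] {ι : Type*} {m : ℕ} (d : ℕ)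
    (P : ι → DP K (Fin m)) (G : DP K (Fin m)) : Prop where
  linearIndependent : LinearIndependent K P
  span_eq : Submodule.span K (Set.range P) = DP.homogeneous K (Fin m) (d - 1)
  homogeneous : G ∈ DP.homogeneous K (Fin m) d

/-- The linear form `∑ a_i x_i + ∑ b_j y_j`. -/
def linearForm {K : Type*} [Field K] {ι : Type*} [Fintype ι] {m : ℕ}
    (a : ι → K) (b : Fin m → K) : MvPolynomial (ι ⊕ Fin m) K :=
  ∑ i, C (a i) * X (Sum.inl i) + ∑ j, C (b j) * X (Sum.inr j)

/-- The vector space `V` has a Jordan basis for the nilpotent endomorphism `f`, consisting of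
strings `z_k, f z_k, …, f^(p_k - 1) z_k` with `f^(p_k) z_k = 0`, whose lengths `p_k` form the
multiset `T`. -/
def HasJordanBasis {K V : Type*} [Field K] [AddCommGroup V] [Module K V]
    (f : Module.End K V) (T : Multiset ℕ) : Prop :=
  ∃ (s : ℕ) (p : Fin s → ℕ) (z : Fin s → V) (B : Module.Basis (Σ k, Fin (p k)) K V),
    (∀ k, 0 < p k) ∧ T = Finset.univ.val.map p ∧
      (∀ k (i : Fin (p k)), B ⟨k, i⟩ = (f ^ (i : ℕ)) (z k)) ∧ ∀ k, (f ^ p k) (z k) = 0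

/-- `T` is the Jordan type of the nilpotent endomorphism `f`, that is, the partition (written as
a multiset of parts) given by the lengths of the strings in any Jordan basis for `f`. -/
def IsJordanType {K V : Type*} [Field K] [AddCommGroup V] [Module K V]
    (f : Module.End K V) (T : Multiset ℕ) : Prop :=
  HasJordanBasis f T ∧ ∀ T', HasJordanBasis f T' → T' = T

/-- `T` is the Jordan type of (the class of) the polynomial `l` in the algebra `A_F`. -/
def IsJordanTypeOf {K : Type*} [Field K] {σ : Type*} (F : DP K σ) (l : MvPolynomial σ K)
    (T : Multiset ℕ) : Prop :=
  IsJordanType (LinearMap.mulLeft K (Ideal.Quotient.mk (Ann F) l : Alg F)) T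

/-- The sum of the `k` largest parts. -/
def partialSum (T : Multiset ℕ) (k : ℕ) : ℕ := ((T.sort (· ≥ ·)).take k).sum

/-- `Q ≤ P` in the dominance order on partitions of the same number. -/
def DomLE (Q P : Multiset ℕ) : Prop :=
  Q.sum = P.sum ∧ ∀ k, 1 ≤ k → k ≤ min P.card Q.card → partialSum Q k ≤ partialSum P k

/-- `Q < P` in the dominance order. -/
def DomLT (Q P : Multiset ℕ) : Prop := DomLE Q P ∧ Q ≠ P

/-- The partition `(2^a, 1^b)` of `N`, where `2 a + b = N`. -/
def typeTwoOne (N a : ℕ) : Multiset ℕ := Multiset.replicate a 2 + Multiset.replicate (N - 2 * a) 1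

/-- The partition `(d^2, (d-1)^(2 * choose (m-1) (m-2)), …, 1^(2 * choose (m+d-3) (m-2)))`. -/
def typeMiddle (m d : ℕ) : Multiset ℕ :=
  Multiset.replicate 2 d +
    ∑ k ∈ Finset.Icc 1 (d - 1), Multiset.replicate (2 * (m - 2 + k).choose (m - 2)) (d - k)

/-- The partition `(d+1, (d-1)^(2m-1), (d-2)^(2 * choose m (m-2)), …,
1^(2 * choose (m+d-3) (m-2)))`. -/
def typeTop (m d : ℕ) : Multiset ℕ :=
  {d + 1} + Multiset.replicate (2 * m - 1) (d - 1) +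
    ∑ k ∈ Finset.Icc 2 (d - 1), Multiset.replicate (2 * (m - 2 + k).choose (m - 2)) (d - k)

/-- The dimension of a compressed Gorenstein algebra of codimension `m` and socle degree
`d - 1`. -/
def aMax (m d : ℕ) : ℕ :=
  if Odd d then
    ((d - 1) / 2 + m - 1).choose (m - 1) +
      2 * ∑ i ∈ Finset.range ((d - 1) / 2), (i + m - 1).choose (m - 1)
  else 2 * ∑ i ∈ Finset.range (d / 2), (i + m - 1).choose (m - 1)

end FullPerazzo

end

/-! The Jordan type of a nilpotent map is determined by the ranks of its powers, and the rank of
`ℓ^i` on `A_F` is `dim R ∘ (ℓ^i ∘ F)` (`finrank_range_mulLeft`). So everything reduces to computing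
dimensions of spaces `R ∘ H`.

If `ℓ` involves only the `x_i`, then `ℓ ∘ F = ∑ a_i P_i` lies in the `Y`-variables and `ℓ^2 ∘ F =
0`, which gives `(2^r, 1^(N-2r))` with `r = dim R ∘ (ℓ ∘ F)`. As the `P_i` form a basis, `ℓ ∘ F` is
an arbitrary nonzero form of degree `d - 1`. Its catalecticants are nonzero in each of the `d`
degrees and bounded in rank by their sizes, so `d ≤ r ≤ aMax`; a power of a variable and a
compressed form attain the bounds.

If some `b_j` is nonzero, put `y = ∑ b_j y_j`. Contraction by `y^i` maps forms of degree `d - 1`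
onto forms of degree `d - 1 - i` (`map_contraction_homogeneous`), so for `i < d` the element `ℓ^i ∘
F` is again of Perazzo shape, of degree `d - i`, with coefficients spanning all forms. Its orbit has
a dimension depending only on `m` and `d - i` (`finrank_orbit_perazzoForm`). Only `ℓ^d ∘ F` is left:
it is a constant, and its vanishing separates `T_1` from `T_2`. It is a value of `G` plus `d` times
a value of `∑ a_i P_i`; since `d ≠ 0` in `K`, both cases occur. -/

noncomputable section

namespace FullPerazzo

/-! ### Jordan types and ranks of powers -/

section Jordan

variable {K V : Type*} [Field K] [AddCommGroup V] [Module K V]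

open Polynomial in
/-- The basis `1, X, …, X^(k-1)` of `K[X] / (X^k)`. -/
theorem exists_basis_quotient_X_pow (K : Type*) [Field K] (k : ℕ) :
    ∃ b : Module.Basis (Fin k) K (K[X] ⧸ (Submodule.span K[X] {(X : K[X]) ^ k})),
      ∀ j : Fin k, b j = Submodule.Quotient.mk ((X : K[X]) ^ (j : ℕ)) := by
  have hm : ((X : K[X]) ^ k).Monic := monic_X_pow k
  have hk : (AdjoinRoot.powerBasis' hm).dim = k := natDegree_X_pow k
  have h : ∀ j, (AdjoinRoot.powerBasis' hm).basis.reindex (finCongr hk) j =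
      AdjoinRoot.mk _ (X ^ (j : ℕ)) := fun j => by
    rw [Module.Basis.reindex_apply, PowerBasis.basis_eq_pow, AdjoinRoot.powerBasis'_gen]
    simp
  exact ⟨(AdjoinRoot.powerBasis' hm).basis.reindex (finCongr hk), h⟩

-- A nilpotent `f` makes `V` an `X`-power torsion module over the principal ideal domain `K[X]`,
-- hence a sum of modules `K[X]/(X^k)`. The powers of `X` in each summand form a string.
open Polynomial in
theorem exists_hasJordanBasis [FiniteDimensional K V] (f : Module.End K V) (hf : IsNilpotent f) :
    ∃ T, HasJordanBasis f T := by
  classical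
  have htors : Module.IsTorsion' (Module.AEval' f) (Submonoid.powers (X : K[X])) := by
    obtain ⟨n, hn⟩ := hf
    intro x
    refine ⟨⟨X ^ n, n, rfl⟩, ?_⟩
    obtain ⟨v, rfl⟩ := (Module.AEval'.of f).surjective x
    change (X ^ n : K[X]) • (Module.AEval'.of f v) = 0
    rw [Module.AEval'.X_pow_smul_of, hn]
    simp
  obtain ⟨n, k, ⟨e₀⟩⟩ := Module.torsion_by_prime_power_decomposition (irreducible_X (R := K)) htors
  let e := e₀.trans (DirectSum.linearEquivFunOnFintype K[X] _ _)
  choose b hb using fun i => exists_basis_quotient_X_pow K (k i)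
  let B₀ : Module.Basis (Σ i, Fin (k i)) K V :=
    (Pi.basis b).map ((e.restrictScalars K).symm.trans (Module.AEval'.of f).symm)
  let z₀ : Fin n → V := fun i =>
    (Module.AEval'.of f).symm (e.symm (LinearMap.single K[X] _ i (Submodule.Quotient.mk 1)))
  have hz : ∀ i (j : ℕ), (f ^ j) (z₀ i) = (Module.AEval'.of f).symm
      (e.symm (LinearMap.single K[X] _ i (Submodule.Quotient.mk (X ^ j)))) := by
    intro i j
    rw [LinearEquiv.eq_symm_apply]
    have := Module.AEval'.X_pow_smul_of f (z₀ i) j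
    rw [Module.End.smul_def] at this
    rw [← this]
    simp only [z₀, LinearEquiv.apply_symm_apply]
    rw [← map_smul, ← map_smul, ← Submodule.Quotient.mk_smul, smul_eq_mul, mul_one]
  have hB₀ : ∀ i (j : Fin (k i)), B₀ ⟨i, j⟩ = (f ^ (j : ℕ)) (z₀ i) := by
    intro i j
    rw [hz, ← hb]
    simp only [B₀, Module.Basis.map_apply, Pi.basis_apply]
    rfl
  have hz0 : ∀ i, (f ^ k i) (z₀ i) = 0 := by
    intro i
    rw [hz, (Submodule.Quotient.mk_eq_zero _).2 (Submodule.mem_span_singleton_self _)]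
    simp
  -- The decomposition may contain zero summands `K[X]/(X^0)`; they are dropped because strings must
  -- be nonempty.
  let I := {i : Fin n // 0 < k i}
  let eI : I ≃ Fin (Fintype.card I) := Fintype.equivFin I
  let g : (Σ i, Fin (k i)) ≃ Σ l : Fin (Fintype.card I), Fin (k (eI.symm l)) :=
    { toFun := fun x => ⟨eI ⟨x.1, x.2.pos⟩, finCongr (by simp) x.2⟩
      invFun := fun y => ⟨eI.symm y.1, y.2⟩
      left_inv := fun x => by
        obtain ⟨i, j⟩ := x
        ext
        · simp
        · simp
          congr 1 <;> simp
      right_inv := fun y => by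
        obtain ⟨i, j⟩ := y
        ext
        · simp
        · simp
          congr 1 <;> simp }
  refine ⟨_, Fintype.card I, fun l => k (eI.symm l), fun l => z₀ (eI.symm l), B₀.reindex g,
    fun l => (eI.symm l).2, rfl, fun l i => ?_, fun l => hz0 _⟩
  rw [Module.Basis.reindex_apply]
  exact hB₀ _ _

theorem HasJordanBasis.pos {f : Module.End K V} {T : Multiset ℕ} (h : HasJordanBasis f T) :
    ∀ p ∈ T, 0 < p := by
  obtain ⟨s, p, z, B, hp, rfl, -⟩ := h
  intro q hq
  obtain ⟨k, -, rfl⟩ := Multiset.mem_map.1 hq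
  exact hp k

/-- `f^i` shifts every string by `i` places, so its image is spanned by the basis vectors in
position at least `i`. A string of length `p` has `p - i` of these, with truncated subtraction. -/
theorem HasJordanBasis.finrank_range_pow {f : Module.End K V} {T : Multiset ℕ}
    (h : HasJordanBasis f T) (i : ℕ) :
    Module.finrank K (LinearMap.range (f ^ i)) = (T.map (· - i)).sum := by
  classical
  obtain ⟨s, p, z, B, hp, rfl, hB, hz⟩ := h
  have hfB : ∀ k (j : Fin (p k)), (f ^ i) (B ⟨k, j⟩) = (f ^ (j + i : ℕ)) (z k) := by
    intro k j
    rw [hB, ← Module.End.mul_apply, ← pow_add, add_comm]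
  have hrange : LinearMap.range (f ^ i) =
      Submodule.span K (Set.range fun x : {x : Σ k, Fin (p k) // i ≤ x.2.1} => B x) := by
    rw [LinearMap.range_eq_map, ← B.span_eq, Submodule.map_span]
    apply le_antisymm
    · rw [Submodule.span_le]
      rintro _ ⟨_, ⟨⟨k, j⟩, rfl⟩, rfl⟩
      rw [SetLike.mem_coe, hfB]
      by_cases hj : j + i < p k
      · refine Submodule.subset_span ⟨⟨⟨k, ⟨j + i, hj⟩⟩, by simp⟩, ?_⟩
        exact hB _ _
      · have : (f ^ (j + i : ℕ)) (z k) = 0 := by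
          rw [← Nat.sub_add_cancel (not_lt.1 hj), pow_add, Module.End.mul_apply, hz, map_zero]
        rw [this]
        exact zero_mem _
    · rw [Submodule.span_le]
      rintro _ ⟨⟨⟨k, j⟩, hj⟩, rfl⟩
      refine Submodule.subset_span
        ⟨B ⟨k, ⟨j - i, (Nat.sub_le _ _).trans_lt j.2⟩⟩, ⟨_, rfl⟩, ?_⟩
      rw [hfB]
      simp only at hj ⊢
      rw [Nat.sub_add_cancel hj, hB]
  rw [hrange, finrank_span_eq_card (b := fun x : {x : Σ k, Fin (p k) // i ≤ x.2.1} => B x)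
      (B.linearIndependent.comp _ Subtype.val_injective),
    Fintype.card_subtype, Multiset.map_map]
  change _ = ∑ k, (p k - i)
  rw [Finset.card_filter, Fintype.sum_sigma]
  refine Finset.sum_congr rfl fun k _ => ?_
  rw [← Finset.card_filter]
  have := Fin.card_filter_val_lt (n := p k) (m := i)
  have h2 := Finset.card_filter_add_card_filter_not (s := (Finset.univ : Finset (Fin (p k))))
    (fun j => j.val < i)
  simp only [not_lt, Finset.card_univ, Fintype.card_fin] at h2
  change Finset.card (Finset.univ.filter fun j : Fin (p k) => i ≤ j.val) = p k - i
  omega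

/-- The second difference of the rank sequence counts the parts of a given size, so the ranks
recover the partition. -/
theorem sum_map_sub_add_sum_map_sub (T : Multiset ℕ) (p : ℕ) :
    (T.map (· - p)).sum + (T.map (· - (p + 2))).sum =
      2 * (T.map (· - (p + 1))).sum + T.count (p + 1) := by
  induction T using Multiset.induction_on with
  | empty => simp
  | cons a T ih =>
    simp only [Multiset.map_cons, Multiset.sum_cons, Multiset.count_cons]
    split_ifs <;> omega

theorem eq_of_sum_map_sub_eq {T T' : Multiset ℕ} (hT : ∀ p ∈ T, 0 < p) (hT' : ∀ p ∈ T', 0 < p)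
    (h : ∀ i, (T.map (· - i)).sum = (T'.map (· - i)).sum) : T = T' := by
  ext p
  rcases p with _ | p
  · rw [Multiset.count_eq_zero_of_notMem fun h => (hT _ h).ne rfl,
      Multiset.count_eq_zero_of_notMem fun h => (hT' _ h).ne rfl]
  · have h1 := sum_map_sub_add_sum_map_sub T p
    have h2 := sum_map_sub_add_sum_map_sub T' p
    rw [h, h, h] at h1
    omega

/-- The Jordan type of a nilpotent endomorphism is determined by the ranks of its powers. -/
theorem isJordanType_of_finrank_range_pow [FiniteDimensional K V] {f : Module.End K V}
    {T : Multiset ℕ} (hT : ∀ p ∈ T, 0 < p)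
    (h : ∀ i, Module.finrank K (LinearMap.range (f ^ i)) = (T.map (· - i)).sum) :
    IsJordanType f T := by
  have huniq : ∀ T', HasJordanBasis f T' → T' = T := fun T' h' =>
    eq_of_sum_map_sub_eq h'.pos hT fun i => by rw [← h'.finrank_range_pow, h]
  -- Nilpotency follows from the rank formula: no part exceeds `T.sum`, so that power of `f` has
  -- rank zero.
  have hnil : IsNilpotent f := by
    refine ⟨T.sum, ?_⟩
    rw [← LinearMap.range_eq_bot, ← Submodule.finrank_eq_zero (R := K), h]
    refine Multiset.sum_eq_zero fun x hx => ?_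
    obtain ⟨q, hq, rfl⟩ := Multiset.mem_map.1 hx
    exact Nat.sub_eq_zero_of_le (Multiset.le_sum_of_mem hq)
  obtain ⟨T', h'⟩ := exists_hasJordanBasis f hnil
  exact ⟨huniq T' h' ▸ h', huniq⟩

end Jordan

/-! ### Binomial sums and the partitions of the chain -/

section Combinatorics

/-- The number of monomials of degree `i` in `m` variables. -/
def numMonomials (m i : ℕ) : ℕ := (i + m - 1).choose (m - 1)

/-- The number of monomials of degree less than `n` in `m` variables. -/
def numMonomialsLT (m n : ℕ) : ℕ := ∑ i ∈ Finset.range n, numMonomials m i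

theorem numMonomials_pos (m i : ℕ) (hm : 2 ≤ m) : 0 < numMonomials m i :=
  Nat.choose_pos (by omega)

theorem numMonomials_zero (m : ℕ) : numMonomials m 0 = 1 := by
  simp [numMonomials]

theorem numMonomials_one {m : ℕ} (hm : 2 ≤ m) : numMonomials m 1 = m := by
  obtain ⟨μ, rfl⟩ := Nat.exists_eq_add_of_le' hm
  simp [numMonomials, add_comm 1]

theorem numMonomials_mono (m : ℕ) : Monotone (numMonomials m) := fun _ _ h =>
  Nat.choose_le_choose _ (by omega)

theorem numMonomialsLT_mono (m : ℕ) : Monotone (numMonomialsLT m) := fun _ _ h =>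
  Finset.sum_le_sum_of_subset (Finset.range_mono h)

theorem sum_range_two_mul_min (f : ℕ → ℕ) (k : ℕ) :
    ∑ i ∈ Finset.range (2 * k), f (min i (2 * k - 1 - i)) = 2 * ∑ i ∈ Finset.range k, f i := by
  rw [two_mul, Finset.sum_range_add, two_mul]
  congr 1
  · refine Finset.sum_congr rfl fun i hi => ?_
    rw [Finset.mem_range] at hi
    congr 1
    omega
  · rw [← Finset.sum_range_reflect f]
    refine Finset.sum_congr rfl fun i hi => ?_
    rw [Finset.mem_range] at hi
    congr 1
    omega

theorem sum_range_two_mul_add_one_min (f : ℕ → ℕ) (k : ℕ) :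
    ∑ i ∈ Finset.range (2 * k + 1), f (min i (2 * k - i)) =
      f k + 2 * ∑ i ∈ Finset.range k, f i := by
  have h : 2 * k + 1 = k + 1 + k := by ring
  rw [h, Finset.sum_range_add, Finset.sum_range_succ, two_mul, two_mul, ← add_assoc,
    add_comm (f k)]
  congr 1
  · congr 1
    · refine Finset.sum_congr rfl fun i hi => ?_
      rw [Finset.mem_range] at hi
      congr 1
      omega
    · congr 1
      omega
  · rw [← Finset.sum_range_reflect f]
    refine Finset.sum_congr rfl fun i hi => ?_
    rw [Finset.mem_range] at hi
    congr 1
    omega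

/-- This is the symmetric Hilbert function of a compressed algebra, in the form in which
catalecticant ranks will be compared with it. -/
theorem aMax_eq_sum (m d : ℕ) :
    aMax m d = ∑ i ∈ Finset.range d, numMonomials m (min i (d - 1 - i)) := by
  unfold aMax
  split_ifs with h
  · obtain ⟨k, rfl⟩ := h
    have : (2 * k + 1 - 1) / 2 = k := by omega
    rw [this]
    exact (sum_range_two_mul_add_one_min (numMonomials m) k).symm
  · obtain ⟨k, rfl⟩ := Nat.not_odd_iff_even.1 h
    rw [← two_mul, Nat.mul_div_cancel_left _ two_pos]
    exact (sum_range_two_mul_min (numMonomials m) k).symm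

/-- Since `N` will turn out to be `2 * numMonomialsLT m d`, this is the inequality `2 * aMax m d ≤
N`. -/
theorem aMax_le_numMonomialsLT (m d : ℕ) : aMax m d ≤ numMonomialsLT m d := by
  rw [aMax_eq_sum]
  exact Finset.sum_le_sum fun i _ => numMonomials_mono m (min_le_left _ _)

/-- The right side is the rank of `ℓ` for type `T_1`; the bound puts `(2^aMax, 1^(N - 2 aMax))`
below `T_1`. -/
theorem aMax_le_two_mul_numMonomialsLT (m d : ℕ) (hd : 3 ≤ d) :
    aMax m d ≤ 2 * numMonomialsLT m (d - 1) := by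
  unfold aMax
  split_ifs with h
  · obtain ⟨k, rfl⟩ := h
    have h1 : (2 * k + 1 - 1) / 2 = k := by omega
    have h2 := numMonomialsLT_mono m (show k + 1 ≤ 2 * k + 1 - 1 by omega)
    rw [numMonomialsLT, Finset.sum_range_succ, numMonomials] at h2
    change _ + 2 * numMonomialsLT m _ ≤ _
    rw [h1]
    change numMonomialsLT m k + _ ≤ _ at h2
    omega
  · exact Nat.mul_le_mul_left 2 (numMonomialsLT_mono m (by omega))

theorem lt_aMax (m d : ℕ) (hm : 2 ≤ m) (hd : 3 ≤ d) : d < aMax m d := by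
  rw [aMax_eq_sum]
  calc d = ∑ i ∈ Finset.range d, 1 := by simp
    _ < _ := by
      refine Finset.sum_lt_sum (fun i _ => numMonomials_pos m _ hm)
        ⟨1, Finset.mem_range.2 (by omega), ?_⟩
      calc 1 < numMonomials m 1 := by rw [numMonomials_one hm]; omega
        _ ≤ _ := numMonomials_mono m (by omega)

/-- Raising `n` by one adds a full sum of binomials, which the hockey-stick identity evaluates. It
turns the multiplicities of `T_1` into ranks, with `μ = m - 2`. -/
theorem sum_choose_mul_sub (μ n : ℕ) :
    ∑ k ∈ Finset.range n, (μ + k).choose μ * (n - k) = numMonomialsLT (μ + 2) n := by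
  induction n with
  | zero => simp [numMonomialsLT]
  | succ n ih =>
    have h : ∀ k ∈ Finset.range (n + 1),
        (μ + k).choose μ * (n + 1 - k) = (μ + k).choose μ * (n - k) + (k + μ).choose μ := by
      intro k hk
      rw [Finset.mem_range] at hk
      rw [Nat.succ_sub (by omega), Nat.mul_succ, add_comm k]
    rw [Finset.sum_congr rfl h, Finset.sum_add_distrib, Nat.sum_range_add_choose,
      Finset.sum_range_succ, ih]
    simp [numMonomialsLT, Finset.sum_range_succ, numMonomials, add_assoc]

theorem sum_choose_mul_sub_of_le (μ : ℕ) {n d : ℕ} (h : n ≤ d) :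
    ∑ k ∈ Finset.range d, (μ + k).choose μ * (n - k) = numMonomialsLT (μ + 2) n := by
  rw [← sum_choose_mul_sub]
  refine (Finset.sum_subset (Finset.range_mono h) fun k _ hk => ?_).symm
  rw [Finset.mem_range] at hk
  rw [Nat.sub_eq_zero_of_le (not_lt.1 hk), mul_zero]

/-- The parts common to `typeMiddle` and `typeTop`. -/
def commonParts (m d : ℕ) : Multiset ℕ :=
  Multiset.replicate (2 * (m - 1)) (d - 1) +
    ∑ k ∈ Finset.Icc 2 (d - 1), Multiset.replicate (2 * (m - 2 + k).choose (m - 2)) (d - k)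

/-- The term `k = 1` has multiplicity `2 * (m - 1)`. Thus `T_1` and `T_2` differ only in two parts:
`d, d` against `d + 1, d - 1`. -/
theorem typeMiddle_eq {m d : ℕ} (hm : 2 ≤ m) (hd : 2 ≤ d) :
    typeMiddle m d = d ::ₘ d ::ₘ commonParts m d := by
  obtain ⟨μ, rfl⟩ := Nat.exists_eq_add_of_le' hm
  rw [typeMiddle, commonParts,
    ← Finset.add_sum_Ioc_eq_sum_Icc (f := fun k => Multiset.replicate _ (d - k)) (by omega : 1 ≤ d - 1)]
  have h1 : μ + 2 - 2 = μ := by omega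
  have h2 : (μ + 1).choose μ = μ + 1 := by simp
  have h3 : Finset.Ioc 1 (d - 1) = Finset.Icc 2 (d - 1) := rfl
  rw [h1, h2, h3, show μ + 2 - 1 = μ + 1 by omega]
  simp [Multiset.replicate_succ]

theorem typeTop_eq {m d : ℕ} (hm : 2 ≤ m) :
    typeTop m d = (d + 1) ::ₘ (d - 1) ::ₘ commonParts m d := by
  obtain ⟨μ, rfl⟩ := Nat.exists_eq_add_of_le' hm
  rw [typeTop, commonParts, show 2 * (μ + 2) - 1 = 2 * (μ + 2 - 1) + 1 by omega]
  simp [Multiset.replicate_succ, Multiset.cons_swap]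

theorem mem_commonParts {m d p : ℕ} (hd : 2 ≤ d) (hp : p ∈ commonParts m d) :
    0 < p ∧ p ≤ d - 1 := by
  rw [commonParts, Multiset.mem_add, Multiset.mem_sum] at hp
  rcases hp with hp | ⟨k, hk, hp⟩
  · have := Multiset.eq_of_mem_replicate hp
    omega
  · have := Multiset.eq_of_mem_replicate hp
    rw [Finset.mem_Icc] at hk
    omega

theorem sum_map_sub_typeMiddle {m d : ℕ} (hm : 2 ≤ m) (hd : 1 ≤ d) (i : ℕ) :
    ((typeMiddle m d).map (· - i)).sum = 2 * numMonomialsLT m (d - i) := by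
  obtain ⟨μ, rfl⟩ := Nat.exists_eq_add_of_le' hm
  rw [← sum_choose_mul_sub_of_le μ (Nat.sub_le d i), Finset.range_eq_Ico,
    Finset.sum_eq_sum_Ico_succ_bot (by omega), typeMiddle, Multiset.map_add, Multiset.sum_add]
  have h := map_sum ((Multiset.sumAddMonoidHom (M := ℕ)).comp
    (Multiset.mapAddMonoidHom (fun x => x - i)))
    (fun k => Multiset.replicate (2 * (μ + 2 - 2 + k).choose (μ + 2 - 2)) (d - k))
    (Finset.Icc 1 (d - 1))
  simp only [AddMonoidHom.comp_apply, Multiset.coe_sumAddMonoidHom,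
    Multiset.coe_mapAddMonoidHom] at h
  rw [h]
  have h3 : Finset.Icc 1 (d - 1) = Finset.Ico (0 + 1) d := by
    ext
    simp
    omega
  rw [h3, mul_add, Finset.mul_sum]
  congr 1
  · simp [two_mul]
  · refine Finset.sum_congr rfl fun k _ => ?_
    simp only [Multiset.map_replicate, Multiset.sum_replicate, smul_eq_mul, add_tsub_cancel_right]
    rw [mul_assoc, Nat.sub_right_comm]

/-- Replacing `d, d` by `d + 1, d - 1` changes the truncated sum only at `i = d`, where the part `d
+ 1` still contributes one. -/
theorem sum_map_sub_typeTop {m d : ℕ} (hm : 2 ≤ m) (hd : 2 ≤ d) (i : ℕ) :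
    ((typeTop m d).map (· - i)).sum = 2 * numMonomialsLT m (d - i) + if i = d then 1 else 0 := by
  rw [← sum_map_sub_typeMiddle hm (by omega), typeMiddle_eq hm hd, typeTop_eq hm]
  simp only [Multiset.map_cons, Multiset.sum_cons]
  split_ifs <;> omega

theorem pos_of_mem_typeMiddle {m d : ℕ} (hm : 2 ≤ m) (hd : 2 ≤ d) : ∀ p ∈ typeMiddle m d, 0 < p := by
  intro p hp
  rw [typeMiddle_eq hm hd, Multiset.mem_cons, Multiset.mem_cons] at hp
  rcases hp with rfl | rfl | hp
  · omega
  · omega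
  · exact (mem_commonParts hd hp).1

theorem pos_of_mem_typeTop {m d : ℕ} (hm : 2 ≤ m) (hd : 2 ≤ d) : ∀ p ∈ typeTop m d, 0 < p := by
  intro p hp
  rw [typeTop_eq hm, Multiset.mem_cons, Multiset.mem_cons] at hp
  rcases hp with rfl | rfl | hp
  · omega
  · omega
  · exact (mem_commonParts hd hp).1

theorem pos_of_mem_typeTwoOne (N a : ℕ) : ∀ p ∈ typeTwoOne N a, 0 < p := by
  intro p hp
  rw [typeTwoOne, Multiset.mem_add] at hp
  rcases hp with hp | hp <;> have := Multiset.eq_of_mem_replicate hp <;> omega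

theorem sum_map_sub_typeTwoOne {N a : ℕ} (h : 2 * a ≤ N) (i : ℕ) :
    ((typeTwoOne N a).map (· - i)).sum = if i = 0 then N else if i = 1 then a else 0 := by
  rcases i with _ | _ | i
  · simp [typeTwoOne]
    omega
  · simp [typeTwoOne]
  · simp [typeTwoOne]

theorem sum_map_sub_zero (T : Multiset ℕ) : (T.map (· - 0)).sum = T.sum := by simp

end Combinatorics

/-! ### The dominance order -/

section Dominance

theorem partialSum_coe {l : List ℕ} (h : l.Pairwise (· ≥ ·)) (k : ℕ) :
    partialSum (l : Multiset ℕ) k = (l.take k).sum := by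
  rw [partialSum, Multiset.coe_sort, List.mergeSort_eq_self]
  exact h.imp fun h => by simpa using h

theorem typeTwoOne_eq_coe (N a : ℕ) :
    typeTwoOne N a = (List.replicate a 2 ++ List.replicate (N - 2 * a) 1 : List ℕ) := by
  rw [← Multiset.coe_add, Multiset.coe_replicate, Multiset.coe_replicate]
  rfl

theorem partialSum_typeTwoOne (N a : ℕ) {k : ℕ} (hk : k ≤ a + (N - 2 * a)) :
    partialSum (typeTwoOne N a) k = k + min k a := by
  rw [typeTwoOne_eq_coe, partialSum_coe]
  · simp only [List.take_append, List.take_replicate, List.sum_append, List.sum_replicate,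
      List.length_replicate, smul_eq_mul]
    omega
  · rw [List.pairwise_append]
    refine ⟨List.pairwise_replicate.2 (Or.inr le_rfl), List.pairwise_replicate.2 (Or.inr le_rfl),
      fun x hx y hy => ?_⟩
    rw [List.eq_of_mem_replicate hx, List.eq_of_mem_replicate hy]
    norm_num

theorem card_typeTwoOne (N a : ℕ) : (typeTwoOne N a).card = a + (N - 2 * a) := by
  simp [typeTwoOne]

theorem sum_typeTwoOne {N a : ℕ} (h : 2 * a ≤ N) : (typeTwoOne N a).sum = N := by
  rw [← sum_map_sub_zero, sum_map_sub_typeTwoOne h]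
  rfl

theorem typeTwoOne_domLT {N r s : ℕ} (hrs : r < s) (hs : 2 * s ≤ N) :
    DomLT (typeTwoOne N r) (typeTwoOne N s) := by
  refine ⟨⟨by rw [sum_typeTwoOne hs, sum_typeTwoOne (by omega)], fun k _ hk => ?_⟩, fun h => ?_⟩
  · rw [card_typeTwoOne, card_typeTwoOne, le_min_iff] at hk
    rw [partialSum_typeTwoOne N r hk.2, partialSum_typeTwoOne N s hk.1]
    omega
  · have := congrArg Multiset.card h
    rw [card_typeTwoOne, card_typeTwoOne] at this
    omega

/-- Each part is one plus an excess. In a nonincreasing list the parts with positive excess come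
first, so the first `k` parts collect either at least `k` units of excess or all of it. -/
theorem le_sum_take {l : List ℕ} (hl : l.Pairwise (· ≥ ·)) (hpos : ∀ p ∈ l, 0 < p) :
    ∀ k ≤ l.length, k + min k (l.map (· - 1)).sum ≤ (l.take k).sum := by
  induction l with
  | nil => simp
  | cons x t ih =>
    intro k hk
    rcases k with _ | k
    · simp
    · have hx := hpos x (by simp)
      have ih' := ih hl.of_cons (fun p hp => hpos p (by simp [hp])) k (by simpa using hk)
      simp only [List.map_cons, List.sum_cons, List.take_succ_cons]
      by_cases hx1 : x = 1
      · have h0 : (t.map (· - 1)).sum = 0 := by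
          refine List.sum_eq_zero fun y hy => ?_
          obtain ⟨z, hz, rfl⟩ := List.mem_map.1 hy
          have := List.rel_of_pairwise_cons hl hz
          omega
        omega
      · omega

/-- The partial sums of `(2^a, 1^(N-2a))` are `k + min k a`, exactly the lower bound of
`le_sum_take` when the total excess is `a`. A part of size at least `3` makes the comparison strict.
-/
theorem typeTwoOne_domLT_of_sum_map_sub {N a : ℕ} (ha : 2 * a ≤ N) {T : Multiset ℕ}
    (hT : T.sum = N) (hpos : ∀ p ∈ T, 0 < p) (h1 : a ≤ (T.map (· - 1)).sum)
    (h3 : ∃ p ∈ T, 3 ≤ p) : DomLT (typeTwoOne N a) T := by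
  refine ⟨⟨by rw [hT, sum_typeTwoOne ha], fun k _ hk => ?_⟩, ?_⟩
  · rw [le_min_iff, card_typeTwoOne] at hk
    rw [partialSum_typeTwoOne N a hk.2]
    have h := le_sum_take (l := T.sort (· ≥ ·)) (Multiset.pairwise_sort _ _)
      (fun p hp => hpos p ((Multiset.mem_sort _).1 hp)) k (by simpa using hk.1)
    have h2 : ((T.sort (· ≥ ·)).map (· - 1)).sum = (T.map (· - 1)).sum := by
      conv_rhs => rw [← Multiset.sort_eq T (· ≥ ·)]
      rfl
    rw [h2] at h
    rw [partialSum]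
    omega
  · rintro rfl
    obtain ⟨p, hp, hp3⟩ := h3
    rw [typeTwoOne, Multiset.mem_add] at hp
    rcases hp with hp | hp <;> have := Multiset.eq_of_mem_replicate hp <;> omega

theorem typeMiddle_domLT_typeTop {m d : ℕ} (hm : 2 ≤ m) (hd : 2 ≤ d) :
    DomLT (typeMiddle m d) (typeTop m d) := by
  set l := (commonParts m d).sort (· ≥ ·) with hl
  have hls : l.Pairwise (· ≥ ·) := Multiset.pairwise_sort _ _
  have hmem : ∀ p ∈ l, p ≤ d - 1 := fun p hp =>
    (mem_commonParts hd ((Multiset.mem_sort _).1 hp)).2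
  have hl' : commonParts m d = (l : Multiset ℕ) := (Multiset.sort_eq _ _).symm
  have h1 : typeMiddle m d = ((d :: d :: l : List ℕ) : Multiset ℕ) := by
    rw [typeMiddle_eq hm hd, hl']
    rfl
  have h2 : typeTop m d = (((d + 1) :: (d - 1) :: l : List ℕ) : Multiset ℕ) := by
    rw [typeTop_eq hm, hl']
    rfl
  refine ⟨⟨?_, fun k hk _ => ?_⟩, fun h => ?_⟩
  · rw [h1, h2]
    simp
    omega
  · rw [h1, h2, partialSum_coe, partialSum_coe]
    · rcases k with _ | _ | k
      · omega
      · simp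
      · simp
        omega
    · simp only [List.pairwise_cons, List.mem_cons]
      refine ⟨?_, hmem, hls⟩
      rintro p (rfl | hp)
      · omega
      · have := hmem p hp
        omega
    · simp only [List.pairwise_cons, List.mem_cons]
      refine ⟨?_, fun p hp => ?_, hls⟩
      · rintro p (rfl | hp)
        · exact le_rfl
        · have := hmem p hp
          omega
      · have := hmem p hp
        omega
  · have h3 := sum_map_sub_typeTop hm hd d
    rw [← h, sum_map_sub_typeMiddle hm (by omega)] at h3
    simp at h3

end Dominance

open MvPolynomial

/-! ### Contraction and the spaces `R ∘ F` -/

section Contraction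

variable {K : Type*} [Field K] {σ : Type*}

/-- The polynomial with the same coefficients as a divided power polynomial. -/
def toPoly (K : Type*) [Field K] (σ : Type*) : DP K σ ≃ₗ[K] MvPolynomial σ K :=
  (AddMonoidAlgebra.coeffLinearEquiv K).symm

theorem coeff_toPoly (u : DP K σ) (α : σ →₀ ℕ) : coeff α (toPoly K σ u) = u α := rfl

theorem toPoly_single (α : σ →₀ ℕ) (c : K) :
    toPoly K σ (Finsupp.single α c) = monomial α c := rfl

theorem contraction_monomial_apply (α : σ →₀ ℕ) (c : K) (F : DP K σ) (γ : σ →₀ ℕ) :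
    contraction K σ (monomial α c) F γ = c * F (γ + α) := by
  have h : contraction K σ (monomial α c) = c • contractMonomial K α :=
    AddMonoidAlgebra.lift_single _ _ _
  rw [h]
  rfl

theorem contraction_apply (f : MvPolynomial σ K) (F : DP K σ) (γ : σ →₀ ℕ) :
    contraction K σ f F γ = ∑ α ∈ f.support, coeff α f * F (γ + α) := by
  conv_lhs => rw [f.as_sum]
  simp only [map_sum, LinearMap.sum_apply, Finsupp.finsetSum_apply, contraction_monomial_apply]

theorem contraction_X_apply (s : σ) (F : DP K σ) (γ : σ →₀ ℕ) :
    contraction K σ (X s) F γ = F (γ + Finsupp.single s 1) := by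
  rw [X, contraction_monomial_apply, one_mul]

theorem contraction_mul (f g : MvPolynomial σ K) (F : DP K σ) :
    contraction K σ (f * g) F = contraction K σ f (contraction K σ g F) := by
  rw [map_mul, Module.End.mul_apply]

theorem contraction_C (c : K) (F : DP K σ) : contraction K σ (C c) F = c • F := by
  ext γ
  rw [C_apply, contraction_monomial_apply, add_zero]
  rfl

theorem contraction_monomial_single_add (α γ : σ →₀ ℕ) (c : K) :
    contraction K σ (monomial α 1) (Finsupp.single (γ + α) c) = Finsupp.single γ c := by
  classical
  ext β
  rw [contraction_monomial_apply, one_mul, Finsupp.single_apply, Finsupp.single_apply]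
  simp

theorem contraction_X_single_add (s : σ) (γ : σ →₀ ℕ) (c : K) :
    contraction K σ (X s) (Finsupp.single (γ + Finsupp.single s 1) c) = Finsupp.single γ c :=
  contraction_monomial_single_add _ _ _

theorem contraction_X_single_of_eq_zero {s : σ} {γ : σ →₀ ℕ} (h : γ s = 0) (c : K) :
    contraction K σ (X s) (Finsupp.single γ c) = 0 := by
  classical
  ext β
  rw [contraction_X_apply, Finsupp.single_apply, if_neg, Finsupp.zero_apply]
  rintro rfl
  simp at h

theorem DP.mem_homogeneous {n : ℕ} {F : DP K σ} :
    F ∈ DP.homogeneous K σ n ↔ ∀ α, α.degree ≠ n → F α = 0 :=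
  Finsupp.mem_supported' _ _

theorem DP.single_mem_homogeneous {n : ℕ} {α : σ →₀ ℕ} (h : α.degree = n) (c : K) :
    Finsupp.single α c ∈ DP.homogeneous K σ n :=
  Finsupp.single_mem_supported K c h

theorem contraction_apply_eq_zero {f : MvPolynomial σ K} {i n : ℕ} (hf : f.IsHomogeneous i)
    {F : DP K σ} (hF : F ∈ DP.homogeneous K σ n) {γ : σ →₀ ℕ} (h : γ.degree + i ≠ n) :
    contraction K σ f F γ = 0 := by
  rw [contraction_apply]
  refine Finset.sum_eq_zero fun α hα => ?_
  rw [DP.mem_homogeneous.1 hF, mul_zero]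
  have hα' : α.degree = i := by
    rw [Finsupp.degree_eq_weight_one]
    exact hf (mem_support_iff.1 hα)
  rwa [map_add, hα']

theorem contraction_mem_homogeneous {f : MvPolynomial σ K} {i e : ℕ} (hf : f.IsHomogeneous i)
    {F : DP K σ} (hF : F ∈ DP.homogeneous K σ (e + i)) :
    contraction K σ f F ∈ DP.homogeneous K σ e :=
  DP.mem_homogeneous.2 fun _ hγ => contraction_apply_eq_zero hf hF fun h => hγ (by omega)

theorem contraction_eq_zero_of_lt {f : MvPolynomial σ K} {i n : ℕ} (hf : f.IsHomogeneous i)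
    {F : DP K σ} (hF : F ∈ DP.homogeneous K σ n) (h : n < i) : contraction K σ f F = 0 :=
  Finsupp.ext fun _ => contraction_apply_eq_zero hf hF (by omega)

/-- The divided power polynomials of degree at most `n`. -/
def DP.degreeLE (K : Type*) [Field K] (σ : Type*) (n : ℕ) : Submodule K (DP K σ) :=
  Finsupp.supported K K {α : σ →₀ ℕ | α.degree ≤ n}

theorem DP.mem_degreeLE {n : ℕ} {F : DP K σ} :
    F ∈ DP.degreeLE K σ n ↔ ∀ α, n < α.degree → F α = 0 := by
  rw [DP.degreeLE, Finsupp.mem_supported']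
  simp

theorem DP.single_mem_degreeLE {n : ℕ} {α : σ →₀ ℕ} (h : α.degree ≤ n) (c : K) :
    Finsupp.single α c ∈ DP.degreeLE K σ n :=
  Finsupp.single_mem_supported K c h

theorem DP.homogeneous_le_degreeLE {i n : ℕ} (h : i ≤ n) :
    DP.homogeneous K σ i ≤ DP.degreeLE K σ n :=
  Finsupp.supported_mono fun α (hα : α.degree = i) => hα.trans_le h

theorem contraction_mem_degreeLE (f : MvPolynomial σ K) {n : ℕ} {F : DP K σ}
    (hF : F ∈ DP.degreeLE K σ n) : contraction K σ f F ∈ DP.degreeLE K σ n := by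
  rw [DP.mem_degreeLE] at hF ⊢
  intro γ hγ
  rw [contraction_apply]
  refine Finset.sum_eq_zero fun α _ => ?_
  rw [hF _ (by rw [map_add]; omega), mul_zero]

instance [Finite σ] (n : ℕ) : Finite {α : σ →₀ ℕ | α.degree ≤ n} :=
  (Finsupp.finite_of_degree_le n).to_subtype

instance [Finite σ] (n : ℕ) : FiniteDimensional K (DP.degreeLE K σ n) :=
  Module.Finite.equiv (Finsupp.supportedEquivFinsupp {α : σ →₀ ℕ | α.degree ≤ n}).symm

theorem DP.degreeLE_le {n : ℕ} {S : Submodule K (DP K σ)}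
    (h : ∀ α : σ →₀ ℕ, α.degree ≤ n → Finsupp.single α 1 ∈ S) : DP.degreeLE K σ n ≤ S := by
  rw [DP.degreeLE, Finsupp.supported_eq_span_single, Submodule.span_le]
  rintro _ ⟨α, hα, rfl⟩
  exact h α hα

/-- The map `f ↦ f ∘ F`. -/
def orbitMap (F : DP K σ) : MvPolynomial σ K →ₗ[K] DP K σ :=
  (LinearMap.applyₗ F).comp (contraction K σ).toLinearMap

theorem orbitMap_apply (F : DP K σ) (f : MvPolynomial σ K) :
    orbitMap F f = contraction K σ f F := rfl

/-- The space `R ∘ F`. -/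
def orbit (F : DP K σ) : Submodule K (DP K σ) := LinearMap.range (orbitMap F)

theorem contraction_mem_orbit (F : DP K σ) (f : MvPolynomial σ K) :
    contraction K σ f F ∈ orbit F := ⟨f, rfl⟩

theorem self_mem_orbit (F : DP K σ) : F ∈ orbit F := ⟨1, by simp [orbitMap_apply]⟩

theorem contraction_mem_orbit_of_mem {F G : DP K σ} (hG : G ∈ orbit F) (f : MvPolynomial σ K) :
    contraction K σ f G ∈ orbit F := by
  obtain ⟨g, rfl⟩ := hG
  exact ⟨f * g, contraction_mul f g F⟩

theorem orbit_le {F : DP K σ} {S : Submodule K (DP K σ)} (hF : F ∈ S)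
    (hS : ∀ s, ∀ G ∈ S, contraction K σ (X s) G ∈ S) : orbit F ≤ S := by
  rintro _ ⟨f, rfl⟩
  rw [orbitMap_apply]
  induction f using MvPolynomial.induction_on with
  | C c =>
    rw [contraction_C]
    exact S.smul_mem c hF
  | add f g hf hg =>
    rw [map_add]
    exact S.add_mem hf hg
  | mul_X f s hf =>
    rw [mul_comm, contraction_mul]
    exact hS s _ hf

theorem orbit_le_degreeLE {F : DP K σ} {n : ℕ} (hF : F ∈ DP.degreeLE K σ n) :
    orbit F ≤ DP.degreeLE K σ n :=
  orbit_le hF fun _ _ => contraction_mem_degreeLE _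

/-- `A_F` is isomorphic to `R ∘ F` as a vector space. -/
def algEquivOrbit (F : DP K σ) : Alg F ≃ₗ[K] orbit F :=
  (Submodule.Quotient.restrictScalarsEquiv K (Ann F)).symm ≪≫ₗ (orbitMap F).quotKerEquivRange

theorem finrank_alg (F : DP K σ) : Module.finrank K (Alg F) = Module.finrank K (orbit F) :=
  (algEquivOrbit F).finrank_eq

theorem finiteDimensional_alg [Finite σ] {F : DP K σ} {n : ℕ} (hF : F ∈ DP.degreeLE K σ n) :
    FiniteDimensional K (Alg F) := by
  have : FiniteDimensional K (orbit F) :=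
    Submodule.finiteDimensional_of_le (orbit_le_degreeLE hF)
  exact Module.Finite.equiv (algEquivOrbit F).symm

/-- The rank of multiplication by `f` on `A_F` is the dimension of `A_{f ∘ F}`. -/
theorem finrank_range_mulLeft (F : DP K σ) (f : MvPolynomial σ K) :
    Module.finrank K (LinearMap.range (LinearMap.mulLeft K (Ideal.Quotient.mk (Ann F) f))) =
      Module.finrank K (orbit (contraction K σ f F)) := by
  let ψ : MvPolynomial σ K →ₗ[K] Alg F :=
    (LinearMap.mulLeft K (Ideal.Quotient.mk (Ann F) f)).comp
      (Ideal.Quotient.mkₐ K (Ann F)).toLinearMap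
  have hψ : LinearMap.range ψ =
      LinearMap.range (LinearMap.mulLeft K (Ideal.Quotient.mk (Ann F) f)) :=
    LinearMap.range_comp_of_range_eq_top _
      (LinearMap.range_eq_top.2 Ideal.Quotient.mk_surjective)
  -- By commutativity, `f g ∈ Ann F` exactly when `g` annihilates `f ∘ F`.
  have hker : LinearMap.ker ψ = LinearMap.ker (orbitMap (contraction K σ f F)) := by
    ext g
    rw [LinearMap.mem_ker, LinearMap.mem_ker, orbitMap_apply, ← contraction_mul, mul_comm]
    change Ideal.Quotient.mk (Ann F) f * Ideal.Quotient.mk (Ann F) g = 0 ↔ _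
    rw [← map_mul, Ideal.Quotient.eq_zero_iff_mem]
    rfl
  rw [← hψ, ← ψ.quotKerEquivRange.finrank_eq, hker,
    (orbitMap (contraction K σ f F)).quotKerEquivRange.finrank_eq]
  rfl

/-- The Jordan type of `l` on `A_F` is determined by the dimensions of `R ∘ (l^i ∘ F)`. -/
theorem isJordanTypeOf_of_finrank [Finite σ] {F : DP K σ} {n : ℕ} (hF : F ∈ DP.degreeLE K σ n)
    {l : MvPolynomial σ K} {T : Multiset ℕ} (hT : ∀ p ∈ T, 0 < p)
    (h : ∀ i, Module.finrank K (orbit (contraction K σ (l ^ i) F)) = (T.map (· - i)).sum) :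
    IsJordanTypeOf F l T := by
  have := finiteDimensional_alg hF
  refine isJordanType_of_finrank_range_pow hT fun i => ?_
  rw [LinearMap.pow_mulLeft, ← map_pow, finrank_range_mulLeft, h]

theorem orbit_zero : orbit (0 : DP K σ) = ⊥ := by
  rw [orbit, LinearMap.range_eq_bot]
  ext
  simp [orbitMap_apply]

theorem finrank_orbit_of_eq_zero {F : DP K σ} (hF : F = 0) : Module.finrank K (orbit F) = 0 := by
  rw [hF, orbit_zero, finrank_bot]

end Contraction

/-! ### Counting monomials -/

section Monomials

theorem card_degree_eq {m : ℕ} (hm : 1 ≤ m) (k : ℕ) :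
    Nat.card {α : Fin m →₀ ℕ // α.degree = k} = numMonomials m k := by
  have h : ∀ α : Fin m →₀ ℕ, α ∈ Finset.finsuppAntidiag Finset.univ k ↔ α.degree = k := by
    intro α
    simp [Finset.mem_finsuppAntidiag, Finsupp.degree_eq_sum]
  rw [Nat.card_congr (Equiv.subtypeEquivRight fun α => (h α).symm), Nat.card_eq_fintype_card,
    Fintype.card_coe, Finset.card_finsuppAntidiag_nat_eq_choose, Finset.card_univ,
    Fintype.card_fin, numMonomials, add_comm k]
  exact Nat.choose_symm_of_eq_add (by omega)

theorem card_degree_le {m : ℕ} (hm : 1 ≤ m) (n : ℕ) :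
    Nat.card {α : Fin m →₀ ℕ // α.degree ≤ n} = numMonomialsLT m (n + 1) := by
  have hfin : ∀ k, Finite {α : Fin m →₀ ℕ // α.degree = k} := fun k =>
    (Finsupp.finite_of_degree_eq k).to_subtype
  let e : {α : Fin m →₀ ℕ // α.degree ≤ n} ≃
      Σ k : Fin (n + 1), {α : Fin m →₀ ℕ // α.degree = k} :=
    { toFun := fun α => ⟨⟨α.1.degree, Nat.lt_succ_of_le α.2⟩, α.1, rfl⟩
      invFun := fun x => ⟨x.2.1, x.2.2.trans_le (Nat.le_of_lt_succ x.1.2)⟩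
      left_inv := fun _ => rfl
      right_inv := by
        rintro ⟨⟨k, hk⟩, α, hα⟩
        obtain rfl : α.degree = k := hα
        rfl }
  rw [Nat.card_congr e, Nat.card_sigma, numMonomialsLT, Finset.sum_range]
  exact Finset.sum_congr rfl fun k _ => card_degree_eq hm k

theorem finrank_degreeLE (K : Type*) [Field K] {m : ℕ} (hm : 1 ≤ m) (n : ℕ) :
    Module.finrank K (DP.degreeLE K (Fin m) n) = numMonomialsLT m (n + 1) := by
  have := Fintype.ofFinite {α : Fin m →₀ ℕ | α.degree ≤ n}
  rw [DP.degreeLE, (Finsupp.supportedEquivFinsupp {α : Fin m →₀ ℕ | α.degree ≤ n}).finrank_eq,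
    Module.finrank_finsupp_self, ← card_degree_le hm]
  exact Nat.card_eq_fintype_card.symm

end Monomials

/-! ### Catalecticant matrices -/

section Catalecticant

variable {K : Type*} [Field K] {σ : Type*}

/-- The exponents of the monomials of degree `n`. -/
abbrev Mon (σ : Type*) (n : ℕ) : Type _ := {α : σ →₀ ℕ // α.degree = n}

instance [Finite σ] (n : ℕ) : Fintype (Mon σ n) :=
  @Fintype.ofFinite _ (Finsupp.finite_of_degree_eq n).to_subtype

theorem card_mon {m : ℕ} (hm : 1 ≤ m) (k : ℕ) : Fintype.card (Mon (Fin m) k) = numMonomials m k := by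
  rw [← card_degree_eq hm, Nat.card_eq_fintype_card]

/-- The form of degree `n` with given coefficients. -/
def formOf [Finite σ] {n : ℕ} (v : Mon σ n → K) : MvPolynomial σ K := ∑ α, monomial α.1 (v α)

theorem isHomogeneous_formOf [Finite σ] {n : ℕ} (v : Mon σ n → K) : (formOf v).IsHomogeneous n :=
  IsHomogeneous.sum _ _ _ fun α _ => isHomogeneous_monomial _ α.2

theorem coeff_formOf [Finite σ] {n : ℕ} (v : Mon σ n → K) (α : Mon σ n) :
    coeff α.1 (formOf v) = v α := by
  classical
  rw [formOf, coeff_sum, Finset.sum_eq_single α]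
  · simp
  · intro β _ hβ
    rw [coeff_monomial, if_neg fun h => hβ (Subtype.ext h)]
  · simp

/-- The matrix of the map `f ↦ f ∘ P` from the forms of degree `k` to those of degree `j`,
for a form `P` of degree `j + k`. -/
def catalecticant (P : DP K σ) (j k : ℕ) : Matrix (Mon σ j) (Mon σ k) K :=
  Matrix.of fun β α => P (β.1 + α.1)

theorem catalecticant_transpose (P : DP K σ) (j k : ℕ) :
    (catalecticant P j k).transpose = catalecticant P k j := by
  ext β α
  simp [catalecticant, add_comm]

/-- As `P` is homogeneous, the degree `j` part of `f ∘ P` sees only the degree `k` part of `f`;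
hence `f` may be arbitrary. -/
theorem contraction_apply_eq_mulVec [Finite σ] {e : ℕ} {P : DP K σ}
    (hP : P ∈ DP.homogeneous K σ e) {j k : ℕ} (hjk : j + k = e) (f : MvPolynomial σ K)
    (β : Mon σ j) :
    contraction K σ f P β.1 = (catalecticant P j k).mulVec (fun α => coeff α.1 f) β := by
  classical
  induction f using MvPolynomial.induction_on' with
  | monomial α c =>
    rw [contraction_monomial_apply, Matrix.mulVec, dotProduct]
    simp only [coeff_monomial, catalecticant, Matrix.of_apply]
    by_cases h : α.degree = k
    · rw [Finset.sum_eq_single ⟨α, h⟩]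
      · simp [mul_comm]
      · intro γ _ hγ
        rw [if_neg fun h => hγ (Subtype.ext h.symm), mul_zero]
      · simp
    · rw [Finset.sum_eq_zero, DP.mem_homogeneous.1 hP, mul_zero]
      · rw [map_add, β.2]
        omega
      · intro γ _
        rw [if_neg, mul_zero]
        rintro rfl
        exact h γ.2
  | add f g hf hg =>
    rw [map_add, LinearMap.add_apply, Finsupp.add_apply, hf, hg, ← Pi.add_apply,
      ← Matrix.mulVec_add]
    rfl

theorem finrank_range_pi {ι : Type*} [Fintype ι] {V : ι → Type*} [∀ i, AddCommGroup (V i)]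
    [∀ i, Module K (V i)] [∀ i, FiniteDimensional K (V i)] (p : ∀ i, Submodule K (V i)) :
    Module.finrank K (Submodule.pi Set.univ p) = ∑ i, Module.finrank K (p i) := by
  let Φ : (∀ i, p i) →ₗ[K] ∀ i, V i := LinearMap.pi fun i => (p i).subtype ∘ₗ LinearMap.proj i
  have hΦ : Function.Injective Φ := fun x y h => by
    ext i
    exact congrFun h i
  have hr : LinearMap.range Φ = Submodule.pi Set.univ p := by
    ext x
    constructor
    · rintro ⟨y, rfl⟩ i -
      exact (y i).2
    · intro hx
      exact ⟨fun i => ⟨x i, hx i trivial⟩, rfl⟩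
  rw [← hr, LinearMap.finrank_range_of_inj hΦ, Module.finrank_pi_fintype]

/-- For homogeneous `P` the space `R ∘ P` is graded, and its degree `j` part is the column space of
a catalecticant. -/
theorem finrank_orbit_eq_sum [Finite σ] {e : ℕ} {P : DP K σ} (hP : P ∈ DP.homogeneous K σ e) :
    Module.finrank K (orbit P) =
      ∑ j ∈ Finset.range (e + 1), (catalecticant P j (e - j)).rank := by
  classical
  let ρ : DP K σ →ₗ[K] ∀ j : Fin (e + 1), (Mon σ j → K) :=
    LinearMap.pi fun j => LinearMap.pi fun β => Finsupp.lapply β.1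
  have hinj : Function.Injective (ρ.domRestrict (orbit P)) := by
    refine (injective_iff_map_eq_zero _).2 ?_
    rintro ⟨F, hF⟩ h
    refine Subtype.ext (Finsupp.ext fun γ => ?_)
    by_cases hγ : γ.degree ≤ e
    · exact congrFun (congrFun h ⟨γ.degree, Nat.lt_succ_of_le hγ⟩) ⟨γ, rfl⟩
    · exact DP.mem_degreeLE.1 (orbit_le_degreeLE (DP.homogeneous_le_degreeLE le_rfl hP) hF) γ
        (not_le.1 hγ)
  have hrange : LinearMap.range (ρ.domRestrict (orbit P)) = Submodule.pi Set.univ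
      fun j : Fin (e + 1) => LinearMap.range (catalecticant P j (e - j)).mulVecLin := by
    ext x
    constructor
    · rintro ⟨⟨_, f, rfl⟩, rfl⟩ j -
      refine ⟨fun α => coeff α.1 f, ?_⟩
      ext β
      exact (contraction_apply_eq_mulVec hP (by omega) f β).symm
    · intro hx
      choose v hv using fun j => hx j trivial
      -- Preimages chosen separately in each degree can be added, since the form of degree `e - j`
      -- affects only degree `j` of the result.
      refine ⟨⟨_, contraction_mem_orbit P (∑ j, formOf (v j))⟩, ?_⟩
      ext j β
      rw [← hv]
      change contraction K σ _ P β.1 = _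
      rw [contraction_apply_eq_mulVec hP (k := e - j) (by omega), Matrix.mulVecLin_apply]
      congr 2
      ext α
      rw [coeff_sum, Finset.sum_eq_single j]
      · exact coeff_formOf _ _
      · intro i _ hij
        refine (isHomogeneous_formOf (v i)).coeff_eq_zero ?_
        rw [α.2]
        have := Fin.val_ne_of_ne hij
        omega
      · simp
  rw [← LinearMap.finrank_range_of_inj hinj, hrange, finrank_range_pi, Finset.sum_range]
  rfl

theorem rank_catalecticant_le {m : ℕ} (hm : 1 ≤ m) (P : DP K (Fin m)) (j k : ℕ) :
    (catalecticant P j k).rank ≤ numMonomials m (min j k) := by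
  rcases le_total j k with h | h
  · rw [min_eq_left h, ← card_mon hm]
    exact Matrix.rank_le_card_height _
  · rw [min_eq_right h, ← card_mon hm]
    exact Matrix.rank_le_card_width _

theorem finrank_orbit_le_aMax {m e : ℕ} (hm : 1 ≤ m) {P : DP K (Fin m)}
    (hP : P ∈ DP.homogeneous K (Fin m) e) : Module.finrank K (orbit P) ≤ aMax m (e + 1) := by
  rw [finrank_orbit_eq_sum hP, aMax_eq_sum]
  exact Finset.sum_le_sum fun j _ => rank_catalecticant_le hm P j _

/-- A monomial occurring in `P` factors as `γ + α` with `γ` of any degree `j ≤ e`. This is a nonzero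
entry in each of the `e + 1` catalecticants. -/
theorem lt_finrank_orbit [Finite σ] {e : ℕ} {P : DP K σ}
    (hP : P ∈ DP.homogeneous K σ e) (h0 : P ≠ 0) : e < Module.finrank K (orbit P) := by
  obtain ⟨β, hβ⟩ := Finsupp.ne_iff.1 h0
  rw [Finsupp.zero_apply] at hβ
  have hβe : β.degree = e := by
    by_contra h
    exact hβ (DP.mem_homogeneous.1 hP β h)
  rw [finrank_orbit_eq_sum hP, ← Nat.succ_le_iff]
  calc e + 1 = ∑ j ∈ Finset.range (e + 1), 1 := by simp
    _ ≤ _ := Finset.sum_le_sum fun j hj => ?_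
  rw [Finset.mem_range] at hj
  obtain ⟨γ, hγ, hγj⟩ := Finsupp.exists_le_degree_eq β j (by omega)
  obtain ⟨α, rfl⟩ := le_iff_exists_add.1 hγ
  have hα : α.degree = e - j := by
    rw [map_add] at hβe
    omega
  rw [Nat.one_le_iff_ne_zero, Matrix.rank, Ne, Submodule.finrank_eq_zero, LinearMap.range_eq_bot]
  intro h
  refine hβ ?_
  classical
  have h2 := congrFun (LinearMap.congr_fun h (Pi.single ⟨α, hα⟩ 1)) ⟨γ, hγj⟩
  simpa [catalecticant] using h2

theorem rank_catalecticant_eq_of_injective [Finite σ] {j k e : ℕ} (hjk : j + k = e)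
    {P : DP K σ} (hP : P ∈ DP.homogeneous K σ e)
    (h : ∀ f : MvPolynomial σ K, f.IsHomogeneous k → contraction K σ f P = 0 → f = 0) :
    (catalecticant P j k).rank = Fintype.card (Mon σ k) := by
  rw [Matrix.rank, LinearMap.finrank_range_of_inj, Module.finrank_pi]
  rw [← LinearMap.ker_eq_bot, LinearMap.ker_eq_bot']
  intro v hv
  have h0 := h (formOf v) (isHomogeneous_formOf v) <| by
    ext γ
    by_cases hγ : γ.degree = j
    · rw [contraction_apply_eq_mulVec hP hjk _ ⟨γ, hγ⟩]
      simp only [coeff_formOf]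
      exact congrFun hv _
    · exact contraction_apply_eq_zero (isHomogeneous_formOf v) hP (by omega)
  ext α
  rw [← coeff_formOf v α, h0, coeff_zero]
  rfl

end Catalecticant

/-! ### Surjectivity of contraction -/

section Surjectivity

variable {K : Type*} [Field K] {σ : Type*}

theorem contraction_single_apply_zero (f : MvPolynomial σ K) (α : σ →₀ ℕ) (c : K) :
    contraction K σ f (Finsupp.single α c) 0 = coeff α f * c := by
  classical
  induction f using MvPolynomial.induction_on' with
  | monomial β b =>
    rw [contraction_monomial_apply, coeff_monomial, zero_add, Finsupp.single_apply]
    by_cases h : α = β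
    · simp [h]
    · simp [h, Ne.symm h]
  | add f g hf hg =>
    rw [map_add, LinearMap.add_apply, Finsupp.add_apply, hf, hg, coeff_add, add_mul]

/-- Contraction with a nonzero form of degree `i` is surjective in each degree. -/
theorem map_contraction_homogeneous [Finite σ] {p : MvPolynomial σ K} {i : ℕ}
    (hp : p.IsHomogeneous i) (hp0 : p ≠ 0) (e : ℕ) :
    (DP.homogeneous K σ (e + i)).map (contraction K σ p) = DP.homogeneous K σ e := by
  refine le_antisymm ?_ ?_
  · rintro _ ⟨F, hF, rfl⟩
    exact contraction_mem_homogeneous hp hF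
  intro G hG
  by_contra hGS
  -- Duality: a functional vanishing on the image is pairing with a form `f` of degree `e`. Then `f
  -- * p` pairs to zero with every monomial, so `f * p = 0`, and `f = 0` because the polynomial ring
  -- is a domain.
  obtain ⟨φ, hφG, hφ⟩ := Submodule.exists_le_ker_of_notMem hGS
  let f : MvPolynomial σ K := formOf fun α : Mon σ e => φ (Finsupp.single α.1 1)
  have hf : f.IsHomogeneous e := isHomogeneous_formOf _
  have hpair : ∀ u ∈ DP.homogeneous K σ e, contraction K σ f u 0 = φ u := by
    intro u hu
    rw [DP.homogeneous, Finsupp.supported_eq_span_single] at hu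
    induction hu using Submodule.span_induction with
    | mem x hx =>
      obtain ⟨α, hα, rfl⟩ := hx
      rw [contraction_single_apply_zero, mul_one]
      exact coeff_formOf (fun α : Mon σ e => φ (Finsupp.single α.1 1)) ⟨α, hα⟩
    | zero => simp
    | add x y _ _ hx hy => rw [map_add, map_add, Finsupp.add_apply, hx, hy]
    | smul c x _ hx => rw [map_smul, map_smul, Finsupp.smul_apply, hx]
  have hfp : f * p = 0 := by
    ext β
    rw [coeff_zero]
    by_cases hβ : β.degree = e + i
    · have hs : Finsupp.single β (1 : K) ∈ DP.homogeneous K σ (e + i) :=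
        DP.single_mem_homogeneous hβ 1
      rw [← mul_one (coeff β (f * p)), ← contraction_single_apply_zero, contraction_mul,
        hpair _ (contraction_mem_homogeneous hp hs)]
      exact hφ (Submodule.mem_map_of_mem hs)
    · exact (hf.mul hp).coeff_eq_zero hβ
  have hf0 : f = 0 := (mul_eq_zero.1 hfp).resolve_right hp0
  refine hφG ?_
  have h0 : contraction K σ 0 = 0 := map_zero _
  rw [← hpair G hG, hf0, h0]
  rfl

end Surjectivity

/-! ### Compressed forms -/

section Compressed

variable {K : Type*} [Field K] {σ : Type*} [Finite σ]

/-- The divided power `L^[n]` of the linear form with coefficients `p`. -/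
def dividedPower (p : σ → K) (n : ℕ) : DP K σ :=
  ∑ γ : Mon σ n, Finsupp.single γ.1 (γ.1.prod fun s k => p s ^ k)

theorem dividedPower_apply (p : σ → K) (n : ℕ) {γ : σ →₀ ℕ} (h : γ.degree = n) :
    dividedPower p n γ = γ.prod fun s k => p s ^ k := by
  classical
  rw [dividedPower, Finsupp.finsetSum_apply, Finset.sum_eq_single ⟨γ, h⟩]
  · simp
  · intro β _ hβ
    rw [Finsupp.single_apply, if_neg fun h => hβ (Subtype.ext h)]
  · simp

theorem dividedPower_mem_homogeneous (p : σ → K) (n : ℕ) :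
    dividedPower p n ∈ DP.homogeneous K σ n :=
  Submodule.sum_mem _ fun γ _ => DP.single_mem_homogeneous γ.2 _

/-- The coefficients `p^γ` are multiplicative in `γ`, so contraction by `f` factors out the value of
`f` at `p`; divided powers leave no factorials. -/
theorem contraction_dividedPower {f : MvPolynomial σ K} {k : ℕ} (hf : f.IsHomogeneous k)
    (p : σ → K) (n : ℕ) :
    contraction K σ f (dividedPower p (n + k)) = eval p f • dividedPower p n := by
  ext γ
  rw [Finsupp.smul_apply, smul_eq_mul]
  by_cases hγ : γ.degree = n
  · rw [contraction_apply, dividedPower_apply p n hγ, eval_eq, Finset.sum_mul]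
    refine Finset.sum_congr rfl fun α hα => ?_
    have hα' : α.degree = k := by
      rw [Finsupp.degree_eq_weight_one]
      exact hf (mem_support_iff.1 hα)
    rw [dividedPower_apply p _ (by rw [map_add, hγ, hα']),
      Finsupp.prod_add_index' (fun _ => pow_zero _) (fun _ _ _ => pow_add _ _ _), mul_assoc,
      mul_comm (γ.prod _)]
    rfl
  · rw [DP.mem_homogeneous.1 (dividedPower_mem_homogeneous p n) γ hγ, mul_zero]
    exact contraction_apply_eq_zero hf (dividedPower_mem_homogeneous p _) (by omega)

/-- Over an infinite field there is a form of degree `2k` whose middle catalecticant is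
invertible. -/
theorem exists_nondegenerate_form [Infinite K] (k : ℕ) : ∃ Q ∈ DP.homogeneous K σ (k + k),
    ∀ f : MvPolynomial σ K, f.IsHomogeneous k → contraction K σ f Q = 0 → f = 0 := by
  let R := homogeneousSubmodule σ K k
  have : FiniteDimensional K R := .of_fg (homogeneousSubmodule_fg σ K k)
  let ev : (σ → K) → Module.Dual K R := fun p => (aeval p).toLinearMap.domRestrict R
  have hev : ∀ p (g : R), ev p g = eval p g.1 := fun p g => by
    simp [ev, aeval_eq_eval]
  -- Points `p i` are chosen whose evaluations form a basis of the span of all evaluations. If `f`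
  -- kills the sum of the powers `L_{p i}^[2k]`, then `∑ f(p i) w i = 0`, so `f` vanishes at each `p
  -- i`, hence everywhere, and is zero as `K` is infinite.
  obtain ⟨w, hw, hspan, hli⟩ := Submodule.exists_fun_fin_finrank_span_eq K (Set.range ev)
  choose p hp using hw
  refine ⟨∑ i, dividedPower (p i) (k + k),
    Submodule.sum_mem _ fun i _ => dividedPower_mem_homogeneous _ _, fun f hf h => ?_⟩
  simp only [map_sum, contraction_dividedPower hf] at h
  have h0 : ∑ i, eval (p i) f • w i = 0 := by
    ext g
    have h1 := congrArg (fun F => contraction K σ g.1 F 0) h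
    simp only [map_sum, map_smul, map_zero] at h1
    have h2 : ∀ q : σ → K, contraction K σ g.1 (dividedPower q k) 0 = ev q g := by
      intro q
      have := contraction_dividedPower g.2 q 0
      rw [zero_add] at this
      rw [this, Finsupp.smul_apply, dividedPower_apply q 0 (map_zero _), hev]
      simp
    simp only [Finsupp.finsetSum_apply, Finsupp.smul_apply, h2] at h1
    simpa [hp] using h1
  have h3 := Fintype.linearIndependent_iff.1 hli _ h0
  have h4 : ∀ q, eval q f = 0 := by
    intro q
    rw [← hev q ⟨f, hf⟩]
    have hq : ev q ∈ Submodule.span K (Set.range w) := by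
      rw [hspan]
      exact Submodule.subset_span ⟨q, rfl⟩
    generalize ev q = x at hq
    induction hq using Submodule.span_induction with
    | mem x hx =>
      obtain ⟨i, rfl⟩ := hx
      rw [← hp, hev]
      exact h3 i
    | zero => rfl
    | add x y _ _ hx hy => rw [LinearMap.add_apply, hx, hy, add_zero]
    | smul c x _ hx => rw [LinearMap.smul_apply, hx, smul_zero]
  exact MvPolynomial.funext fun q => by rw [h4, map_zero]

/-- Over an infinite field there are compressed forms of all degrees. -/
theorem exists_compressed_form [Infinite K] {m : ℕ} (hm : 1 ≤ m) (e : ℕ) :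
    ∃ P ∈ DP.homogeneous K (Fin m) e, Module.finrank K (orbit P) = aMax m (e + 1) := by
  let s : Fin m := ⟨0, hm⟩
  have hX : ∀ i, ((X s : MvPolynomial (Fin m) K) ^ i).IsHomogeneous i := fun i => by
    simpa using (isHomogeneous_X K s).pow i
  have hX0 : ∀ i, (X s : MvPolynomial (Fin m) K) ^ i ≠ 0 := fun i => pow_ne_zero _ (X_ne_zero s)
  -- In odd degree, `P` is a preimage of the even-degree form `Q` under contraction by a variable;
  -- whatever kills `P` also kills `Q`.
  obtain ⟨P, hP, hinj⟩ : ∃ P ∈ DP.homogeneous K (Fin m) e, ∀ f : MvPolynomial (Fin m) K,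
      f.IsHomogeneous (e / 2) → contraction K _ f P = 0 → f = 0 := by
    obtain ⟨Q, hQ, h⟩ := exists_nondegenerate_form (K := K) (σ := Fin m) (e / 2)
    rw [← map_contraction_homogeneous (hX (e % 2)) (hX0 _),
      show e / 2 + e / 2 + e % 2 = e by omega] at hQ
    obtain ⟨P, hP, rfl⟩ := hQ
    refine ⟨P, hP, fun f hf hfP => h f hf ?_⟩
    rw [← contraction_mul, mul_comm, contraction_mul, hfP, map_zero]
  -- Multiplying by a power of a variable reduces lower degrees to the middle one.
  have hinj' : ∀ k ≤ e / 2, ∀ f : MvPolynomial (Fin m) K,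
      f.IsHomogeneous k → contraction K _ f P = 0 → f = 0 := by
    intro k hk f hf hfP
    refine (mul_eq_zero.1 (hinj (X s ^ (e / 2 - k) * f) ?_ ?_)).resolve_left (hX0 _)
    · simpa [Nat.sub_add_cancel hk] using (hX (e / 2 - k)).mul hf
    · rw [contraction_mul, hfP, map_zero]
  refine ⟨P, hP, ?_⟩
  rw [finrank_orbit_eq_sum hP, aMax_eq_sum]
  refine Finset.sum_congr rfl fun j hj => ?_
  rw [Finset.mem_range] at hj
  rw [← card_mon hm]
  rcases le_or_gt j (e / 2) with h | h
  -- In the lower half the injective map is the transposed catalecticant.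
  · rw [← Matrix.rank_transpose, catalecticant_transpose,
      rank_catalecticant_eq_of_injective (by omega) hP (hinj' j h),
      show min j (e + 1 - 1 - j) = j by omega]
  · rw [rank_catalecticant_eq_of_injective (by omega) hP (hinj' (e - j) (by omega)),
      show min j (e + 1 - 1 - j) = e - j by omega]

end Compressed

/-! ### The form with the smallest algebra -/

section PowerOfVariable

variable {K : Type*} [Field K] {σ : Type*}

/-- The algebra of a power of a variable has dimension at most one more than the degree. -/
theorem finrank_orbit_single_le (s : σ) (e : ℕ) :
    Module.finrank K (orbit (Finsupp.single (Finsupp.single s e) (1 : K))) ≤ e + 1 := by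
  classical
  let b : Fin (e + 1) → DP K σ := fun j => Finsupp.single (Finsupp.single s (j : ℕ)) 1
  have hle : orbit (Finsupp.single (Finsupp.single s e) (1 : K)) ≤
      Submodule.span K (Set.range b) := by
    refine orbit_le (Submodule.subset_span ⟨Fin.last e, rfl⟩) fun t G hG => ?_
    induction hG using Submodule.span_induction with
    | mem x hx =>
      obtain ⟨⟨j, hj⟩, rfl⟩ := hx
      change contraction K σ (X t) (Finsupp.single (Finsupp.single s j) 1) ∈ _
      by_cases hst : s = t
      · subst hst
        rcases j with _ | j
        · rw [contraction_X_single_of_eq_zero (by simp)]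
          exact zero_mem _
        · rw [Finsupp.single_add, contraction_X_single_add]
          exact Submodule.subset_span ⟨⟨j, by omega⟩, rfl⟩
      · rw [contraction_X_single_of_eq_zero (by simp [hst])]
        exact zero_mem _
    | zero => simp
    | add x y _ _ hx hy =>
      rw [map_add]
      exact add_mem hx hy
    | smul c x _ hx =>
      rw [map_smul]
      exact Submodule.smul_mem _ c hx
  have : FiniteDimensional K (Submodule.span K (Set.range b)) :=
    FiniteDimensional.span_of_finite K (Set.finite_range b)
  exact (Submodule.finrank_mono hle).trans ((finrank_range_le_card b).trans (by simp))

end PowerOfVariable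

/-! ### The space `R ∘ H` for a form of Perazzo shape -/

section Perazzo

variable {K : Type*} [Field K] {ι : Type*} {m : ℕ}

/-- `inclY` as a linear map. -/
def inclYHom (K : Type*) [Field K] (ι : Type*) (m : ℕ) : DP K (Fin m) →ₗ[K] DP K (ι ⊕ Fin m) :=
  Finsupp.lmapDomain K K fun α : Fin m →₀ ℕ => α.mapDomain Sum.inr

theorem inclYHom_apply (G : DP K (Fin m)) : inclYHom K ι m G = inclY ι G := rfl

theorem inclYHom_injective : Function.Injective (inclYHom K ι m) :=
  Finsupp.mapDomain_injective (Finsupp.mapDomain_injective Sum.inr_injective)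

theorem inclY_single (β : Fin m →₀ ℕ) (c : K) :
    inclY ι (Finsupp.single β c) = Finsupp.single (β.mapDomain Sum.inr) c :=
  Finsupp.mapDomain_single

/-- Multiplication by `X_i` as a linear map. -/
def varMulHom (K : Type*) [Field K] (m : ℕ) (i : ι) : DP K (Fin m) →ₗ[K] DP K (ι ⊕ Fin m) :=
  Finsupp.lmapDomain K K
    fun α : Fin m →₀ ℕ => Finsupp.single (Sum.inl i) 1 + α.mapDomain Sum.inr

theorem varMulHom_apply (i : ι) (P : DP K (Fin m)) : varMulHom K m i P = varMul i P := rfl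

theorem varMul_single (i : ι) (β : Fin m →₀ ℕ) (c : K) :
    varMul i (Finsupp.single β c) =
      Finsupp.single (Finsupp.single (Sum.inl i) 1 + β.mapDomain Sum.inr) c :=
  Finsupp.mapDomain_single

theorem mapDomain_inr_apply_inl (β : Fin m →₀ ℕ) (i : ι) :
    β.mapDomain (Sum.inr : Fin m → ι ⊕ Fin m) (Sum.inl i) = 0 :=
  Finsupp.mapDomain_of_notMem_range _ _ (by simp)

theorem mapDomain_inr_apply_inr (β : Fin m →₀ ℕ) (j : Fin m) :
    β.mapDomain (Sum.inr : Fin m → ι ⊕ Fin m) (Sum.inr j) = β j :=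
  Finsupp.mapDomain_apply Sum.inr_injective _ _

theorem eq_add_single_of_ne_zero {σ : Type*} {β : σ →₀ ℕ} {s : σ} (h : β s ≠ 0) :
    ∃ γ, β = γ + Finsupp.single s 1 := by
  obtain ⟨γ, hγ⟩ := le_iff_exists_add.1
    (Finsupp.single_le_iff.2 (Nat.one_le_iff_ne_zero.2 h) : Finsupp.single s 1 ≤ β)
  exact ⟨γ, by rw [hγ, add_comm]⟩

theorem contraction_X_inr_inclY (j : Fin m) (G : DP K (Fin m)) :
    contraction K (ι ⊕ Fin m) (X (Sum.inr j)) (inclY ι G) = inclY ι (contraction K _ (X j) G) := by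
  simp only [← inclYHom_apply]
  induction G using Finsupp.induction_linear with
  | zero => simp
  | add f g hf hg => simp only [map_add, hf, hg]
  | single β c =>
    rw [inclYHom_apply, inclY_single]
    by_cases h : β j = 0
    · rw [contraction_X_single_of_eq_zero h, contraction_X_single_of_eq_zero, map_zero]
      rwa [mapDomain_inr_apply_inr]
    · obtain ⟨γ, rfl⟩ := eq_add_single_of_ne_zero h
      rw [contraction_X_single_add, Finsupp.mapDomain_add, Finsupp.mapDomain_single,
        contraction_X_single_add, inclYHom_apply, inclY_single]

theorem contraction_X_inl_inclY (i : ι) (G : DP K (Fin m)) :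
    contraction K (ι ⊕ Fin m) (X (Sum.inl i)) (inclY ι G) = 0 := by
  simp only [← inclYHom_apply]
  induction G using Finsupp.induction_linear with
  | zero => simp
  | add f g hf hg => simp only [map_add, hf, hg, add_zero]
  | single β c =>
    rw [inclYHom_apply, inclY_single,
      contraction_X_single_of_eq_zero (mapDomain_inr_apply_inl β i)]

theorem contraction_X_inr_varMul (i : ι) (j : Fin m) (P : DP K (Fin m)) :
    contraction K (ι ⊕ Fin m) (X (Sum.inr j)) (varMul i P) =
      varMul i (contraction K _ (X j) P) := by
  simp only [← varMulHom_apply]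
  induction P using Finsupp.induction_linear with
  | zero => simp
  | add f g hf hg => simp only [map_add, hf, hg]
  | single β c =>
    rw [varMulHom_apply, varMul_single]
    by_cases h : β j = 0
    · rw [contraction_X_single_of_eq_zero h, contraction_X_single_of_eq_zero, map_zero]
      simp [mapDomain_inr_apply_inr, h]
    · obtain ⟨γ, rfl⟩ := eq_add_single_of_ne_zero h
      rw [contraction_X_single_add, Finsupp.mapDomain_add, Finsupp.mapDomain_single, ← add_assoc,
        contraction_X_single_add, varMulHom_apply, varMul_single]

theorem contraction_X_inl_varMul_self (i : ι) (P : DP K (Fin m)) :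
    contraction K (ι ⊕ Fin m) (X (Sum.inl i)) (varMul i P) = inclY ι P := by
  simp only [← varMulHom_apply, ← inclYHom_apply]
  induction P using Finsupp.induction_linear with
  | zero => simp
  | add f g hf hg => simp only [map_add, hf, hg]
  | single β c =>
    rw [varMulHom_apply, varMul_single, add_comm, contraction_X_single_add, inclYHom_apply,
      inclY_single]

theorem contraction_X_inl_varMul_of_ne {i k : ι} (h : k ≠ i) (P : DP K (Fin m)) :
    contraction K (ι ⊕ Fin m) (X (Sum.inl i)) (varMul k P) = 0 := by
  simp only [← varMulHom_apply]
  induction P using Finsupp.induction_linear with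
  | zero => simp
  | add f g hf hg => simp only [map_add, hf, hg, add_zero]
  | single β c =>
    rw [varMulHom_apply, varMul_single, contraction_X_single_of_eq_zero]
    simp [mapDomain_inr_apply_inl, h]

theorem contraction_rename_inclY (f : MvPolynomial (Fin m) K) (G : DP K (Fin m)) :
    contraction K (ι ⊕ Fin m) (rename Sum.inr f) (inclY ι G) =
      inclY ι (contraction K _ f G) := by
  simp only [← inclYHom_apply]
  induction f using MvPolynomial.induction_on generalizing G with
  | C c => rw [rename_C, contraction_C, contraction_C, map_smul]
  | add f g hf hg => simp only [map_add, LinearMap.add_apply, hf, hg]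
  | mul_X f j hf =>
    rw [map_mul, rename_X, contraction_mul, contraction_mul, inclYHom_apply,
      contraction_X_inr_inclY, ← inclYHom_apply, hf]

theorem contraction_rename_varMul (f : MvPolynomial (Fin m) K) (i : ι) (P : DP K (Fin m)) :
    contraction K (ι ⊕ Fin m) (rename Sum.inr f) (varMul i P) =
      varMul i (contraction K _ f P) := by
  simp only [← varMulHom_apply]
  induction f using MvPolynomial.induction_on generalizing P with
  | C c => rw [rename_C, contraction_C, contraction_C, map_smul]
  | add f g hf hg => simp only [map_add, LinearMap.add_apply, hf, hg]
  | mul_X f j hf =>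
    rw [map_mul, rename_X, contraction_mul, contraction_mul, varMulHom_apply,
      contraction_X_inr_varMul, ← varMulHom_apply, hf]

theorem finrank_orbit_inclY (G : DP K (Fin m)) :
    Module.finrank K (orbit (inclY ι G)) = Module.finrank K (orbit G) := by
  have h : orbit (inclY ι G) = (orbit G).map (inclYHom K ι m) := by
    apply le_antisymm
    · refine orbit_le ⟨G, self_mem_orbit G, rfl⟩ ?_
      rintro (i | j) _ ⟨H, hH, rfl⟩
      · rw [inclYHom_apply, contraction_X_inl_inclY]
        exact zero_mem _
      · rw [inclYHom_apply, contraction_X_inr_inclY]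
        exact ⟨_, contraction_mem_orbit_of_mem hH _, rfl⟩
    · rintro _ ⟨_, ⟨f, rfl⟩, rfl⟩
      rw [inclYHom_apply, orbitMap_apply, ← contraction_rename_inclY]
      exact contraction_mem_orbit _ _
  rw [h, ← (Submodule.equivMapOfInjective _ inclYHom_injective (orbit G)).finrank_eq]

/-- The map whose image is `R ∘ H` for a full Perazzo form `H` of degree `e + 1`. -/
def perazzoMap (e : ℕ) (H : DP K (ι ⊕ Fin m)) :
    (DP.degreeLE K (Fin m) e × DP.degreeLE K (Fin m) e) →ₗ[K] DP K (ι ⊕ Fin m) :=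
  (orbitMap H ∘ₗ (rename Sum.inr).toLinearMap ∘ₗ (toPoly K (Fin m)).toLinearMap ∘ₗ
    (DP.degreeLE K (Fin m) e).subtype).coprod (inclYHom K ι m ∘ₗ (DP.degreeLE K (Fin m) e).subtype)

theorem perazzoMap_apply (e : ℕ) (H : DP K (ι ⊕ Fin m))
    (x : DP.degreeLE K (Fin m) e × DP.degreeLE K (Fin m) e) :
    perazzoMap e H x = contraction K _ (rename Sum.inr (toPoly K _ x.1.1)) H + inclY ι x.2.1 := rfl

variable [Fintype ι]

theorem perazzoForm_add_inclY (P : ι → DP K (Fin m)) (G H : DP K (Fin m)) :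
    perazzoForm P G + inclY ι H = perazzoForm P (G + H) := by
  simp only [perazzoForm, ← inclYHom_apply, map_add, add_assoc]

theorem perazzoForm_zero_left (G : DP K (Fin m)) :
    perazzoForm (0 : ι → DP K (Fin m)) G = inclY ι G := by
  simp [perazzoForm, ← varMulHom_apply]

theorem contraction_rename_perazzoForm (f : MvPolynomial (Fin m) K) (P : ι → DP K (Fin m))
    (G : DP K (Fin m)) :
    contraction K (ι ⊕ Fin m) (rename Sum.inr f) (perazzoForm P G) =
      perazzoForm (fun i => contraction K _ f (P i)) (contraction K _ f G) := by
  simp only [perazzoForm, map_add, map_sum, contraction_rename_inclY, contraction_rename_varMul]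

theorem contraction_X_inl_perazzoForm (i : ι) (P : ι → DP K (Fin m)) (G : DP K (Fin m)) :
    contraction K (ι ⊕ Fin m) (X (Sum.inl i)) (perazzoForm P G) = inclY ι (P i) := by
  classical
  rw [perazzoForm, map_add, map_sum, contraction_X_inl_inclY, add_zero, Finset.sum_eq_single i,
    contraction_X_inl_varMul_self]
  · exact fun k _ hk => contraction_X_inl_varMul_of_ne hk _
  · simp

theorem perazzoForm_mem_degreeLE {P : ι → DP K (Fin m)} {G : DP K (Fin m)} {d : ℕ}
    (hP : ∀ i, P i ∈ DP.degreeLE K (Fin m) d) (hG : G ∈ DP.degreeLE K (Fin m) (d + 1)) :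
    perazzoForm P G ∈ DP.degreeLE K (ι ⊕ Fin m) (d + 1) := by
  refine add_mem (sum_mem fun i _ => ?_) ?_
  · have h : DP.degreeLE K (Fin m) d ≤
        (DP.degreeLE K (ι ⊕ Fin m) (d + 1)).comap (varMulHom K m i) :=
      DP.degreeLE_le fun α hα => by
        rw [Submodule.mem_comap, varMulHom_apply, varMul_single]
        refine DP.single_mem_degreeLE ?_ 1
        rw [map_add, Finsupp.degree_single, Finsupp.degree_mapDomain]
        omega
    exact h (hP i)
  · have h : DP.degreeLE K (Fin m) (d + 1) ≤
        (DP.degreeLE K (ι ⊕ Fin m) (d + 1)).comap (inclYHom K ι m) :=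
      DP.degreeLE_le fun α hα => by
        rw [Submodule.mem_comap, inclYHom_apply, inclY_single]
        refine DP.single_mem_degreeLE ?_ 1
        rwa [Finsupp.degree_mapDomain]
    exact h hG

/-- A polynomial of degree at most `e` which annihilates all forms of degree `e` is zero. -/
theorem eq_zero_of_contraction_homogeneous_eq_zero (hm : 1 ≤ m) {e : ℕ} {u : DP K (Fin m)}
    (hu : u ∈ DP.degreeLE K (Fin m) e)
    (h : ∀ Q ∈ DP.homogeneous K (Fin m) e, contraction K _ (toPoly K _ u) Q = 0) : u = 0 := by
  ext α
  by_cases hα : α.degree ≤ e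
  -- `S` pads `α` to degree `e`; contracting further by `S` then isolates the coefficient of `u` at
  -- `α`.
  · let S : Fin m →₀ ℕ := Finsupp.single ⟨0, hm⟩ (e - α.degree)
    have h1 := h (Finsupp.single (α + S) 1) <| DP.single_mem_homogeneous
      (by rw [map_add, Finsupp.degree_single]; omega) 1
    have h2 := contraction_single_apply_zero (toPoly K _ u * monomial S 1) (α + S) 1
    rw [coeff_mul_monomial, coeff_toPoly, mul_one, mul_one, mul_comm, contraction_mul, h1,
      LinearMap.map_zero] at h2
    exact h2.symm
  · exact DP.mem_degreeLE.1 hu α (not_le.1 hα)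

/-- Contraction by `x_i` removes the `Y`-part and leaves `u ∘ Q_i`. Thus `u` kills every form of
degree `e`, so `u = 0`, and then `g = 0`. -/
theorem perazzoMap_injective (hm : 1 ≤ m) {e : ℕ} {Q : ι → DP K (Fin m)} {G : DP K (Fin m)}
    (hQ : Submodule.span K (Set.range Q) = DP.homogeneous K (Fin m) e) :
    Function.Injective (perazzoMap e (perazzoForm Q G)) := by
  refine (injective_iff_map_eq_zero _).2 ?_
  rintro ⟨⟨u, hu⟩, g, hg⟩ h
  rw [perazzoMap_apply] at h
  simp only at h
  have hu0 : u = 0 := by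
    refine eq_zero_of_contraction_homogeneous_eq_zero hm hu fun R hR => ?_
    rw [← hQ] at hR
    have hle : Submodule.span K (Set.range Q) ≤
        LinearMap.ker (contraction K (Fin m) (toPoly K _ u)) := by
      rw [Submodule.span_le]
      rintro _ ⟨i, rfl⟩
      have h1 := congrArg (contraction K _ (X (Sum.inl i))) h
      rw [map_add, contraction_X_inl_inclY, add_zero, map_zero, ← contraction_mul, mul_comm,
        contraction_mul, contraction_X_inl_perazzoForm, contraction_rename_inclY,
        ← inclYHom_apply] at h1
      exact (map_eq_zero_iff _ inclYHom_injective).1 h1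
    exact hle hR
  subst hu0
  have h0 : contraction K (ι ⊕ Fin m) 0 = 0 := map_zero _
  rw [map_zero, map_zero, h0, LinearMap.zero_apply, zero_add, ← inclYHom_apply] at h
  obtain rfl := (map_eq_zero_iff _ inclYHom_injective).1 h
  rfl

theorem range_perazzoMap (hm : 1 ≤ m) {e : ℕ} {Q : ι → DP K (Fin m)} {G : DP K (Fin m)}
    (hQ : Submodule.span K (Set.range Q) = DP.homogeneous K (Fin m) e)
    (hG : G ∈ DP.homogeneous K (Fin m) (e + 1)) :
    LinearMap.range (perazzoMap e (perazzoForm Q G)) = orbit (perazzoForm Q G) := by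
  have hQi : ∀ i, Q i ∈ DP.homogeneous K (Fin m) e := fun i =>
    hQ ▸ Submodule.subset_span ⟨i, rfl⟩
  apply le_antisymm
  · rintro _ ⟨⟨⟨u, hu⟩, g, hg⟩, rfl⟩
    rw [perazzoMap_apply]
    refine add_mem (contraction_mem_orbit _ _) ?_
    -- Contraction by the `x_i` yields the `Q_i`, which span degree `e`; lower degrees follow by
    -- contracting with monomials in the `y_j`.
    have hle : DP.homogeneous K (Fin m) e ≤
        (orbit (perazzoForm Q G)).comap (inclYHom K ι m) := by
      rw [← hQ, Submodule.span_le]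
      rintro _ ⟨i, rfl⟩
      rw [SetLike.mem_coe, Submodule.mem_comap, inclYHom_apply,
        ← contraction_X_inl_perazzoForm i Q G]
      exact contraction_mem_orbit _ _
    have hle' : DP.degreeLE K (Fin m) e ≤
        (orbit (perazzoForm Q G)).comap (inclYHom K ι m) := by
      refine DP.degreeLE_le fun α hα => ?_
      let S : Fin m →₀ ℕ := Finsupp.single ⟨0, hm⟩ (e - α.degree)
      have h1 := hle <| DP.single_mem_homogeneous (α := α + S)
        (by rw [map_add, Finsupp.degree_single]; omega) 1
      rw [← contraction_monomial_single_add S α, Submodule.mem_comap, inclYHom_apply,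
        ← contraction_rename_inclY]
      exact contraction_mem_orbit_of_mem h1 _
    exact hle' hg
  · have hincl : ∀ g ∈ DP.degreeLE K (Fin m) e,
        inclY ι g ∈ LinearMap.range (perazzoMap e (perazzoForm Q G)) := fun g hg =>
      ⟨(0, ⟨g, hg⟩), by
        have h0 : contraction K (ι ⊕ Fin m) 0 = 0 := map_zero _
        simp [perazzoMap_apply, h0]⟩
    have hmon : ∀ f : MvPolynomial (Fin m) K, contraction K _ (rename Sum.inr f)
        (perazzoForm Q G) ∈ LinearMap.range (perazzoMap e (perazzoForm Q G)) := by
      intro f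
      induction f using MvPolynomial.induction_on' with
      | monomial α c =>
        by_cases hα : α.degree ≤ e
        · refine ⟨(⟨_, DP.single_mem_degreeLE hα c⟩, 0), ?_⟩
          rw [perazzoMap_apply, toPoly_single, ← inclYHom_apply]
          simp
        -- A monomial of degree above `e` kills every `Q_i`; what remains comes from `G` and has
        -- degree at most `e`.
        · have hmon := isHomogeneous_monomial c (rfl : α.degree = α.degree)
          have h0 : (fun i => contraction K (Fin m) (monomial α c) (Q i)) = 0 :=
            funext fun i => contraction_eq_zero_of_lt hmon (hQi i) (not_le.1 hα)
          rw [contraction_rename_perazzoForm, h0, perazzoForm_zero_left]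
          refine hincl _ (DP.mem_degreeLE.2 fun γ hγ => ?_)
          exact contraction_apply_eq_zero hmon hG (by omega)
      | add f g hf hg =>
        rw [map_add, map_add, LinearMap.add_apply]
        exact add_mem hf hg
    refine orbit_le (by simpa using hmon 1) ?_
    rintro (i | j) _ ⟨⟨⟨u, hu⟩, g, hg⟩, rfl⟩
    · rw [perazzoMap_apply, map_add, contraction_X_inl_inclY, add_zero, ← contraction_mul,
        mul_comm, contraction_mul, contraction_X_inl_perazzoForm, contraction_rename_inclY]
      exact hincl _ (contraction_mem_degreeLE _ (DP.homogeneous_le_degreeLE le_rfl (hQi i)))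
    · rw [perazzoMap_apply, map_add, contraction_X_inr_inclY, ← contraction_mul, ← rename_X,
        ← map_mul]
      exact add_mem (hmon _) (hincl _ (contraction_mem_degreeLE _ hg))

/-- The `Q_i` are only required to span: after contraction by `y^i` the `P_k` still span but may
become linearly dependent. -/
theorem finrank_orbit_perazzoForm (hm : 1 ≤ m) {e : ℕ} {Q : ι → DP K (Fin m)}
    {G : DP K (Fin m)} (hQ : Submodule.span K (Set.range Q) = DP.homogeneous K (Fin m) e)
    (hG : G ∈ DP.homogeneous K (Fin m) (e + 1)) :
    Module.finrank K (orbit (perazzoForm Q G)) = 2 * numMonomialsLT m (e + 1) := by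
  have : Module.Free K (DP.degreeLE K (Fin m) e) :=
    Module.Free.of_equiv (Finsupp.supportedEquivFinsupp {α : Fin m →₀ ℕ | α.degree ≤ e}).symm
  rw [← range_perazzoMap hm hQ hG, LinearMap.finrank_range_of_inj (perazzoMap_injective hm hQ),
    Module.finrank_prod, finrank_degreeLE K hm, two_mul]

end Perazzo

/-! ### Powers of a linear form acting on `F` -/

section LinearForms

variable {K : Type*} [Field K] {ι : Type*} [Fintype ι] {m : ℕ}

/-- The linear form `∑ b_j y_j`. -/
def yForm (b : Fin m → K) : MvPolynomial (Fin m) K := ∑ j, C (b j) * X j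

theorem isHomogeneous_yForm (b : Fin m → K) : (yForm b).IsHomogeneous 1 :=
  IsHomogeneous.sum _ _ _ fun j _ => by
    simpa using (isHomogeneous_C (Fin m) (b j)).mul (isHomogeneous_X K j)

theorem isHomogeneous_yForm_pow (b : Fin m → K) (i : ℕ) : (yForm b ^ i).IsHomogeneous i := by
  simpa using (isHomogeneous_yForm b).pow i

theorem yForm_ne_zero {b : Fin m → K} (hb : b ≠ 0) : yForm b ≠ 0 := by
  classical
  intro h
  refine hb (funext fun j => ?_)
  have h1 := congrArg (coeff (Finsupp.single j 1)) h
  simpa [yForm, coeff_sum, coeff_C_mul, coeff_X, Finsupp.single_left_inj] using h1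

theorem linearForm_eq (a : ι → K) (b : Fin m → K) :
    linearForm a b = linearForm a 0 + rename Sum.inr (yForm b) := by
  simp [linearForm, yForm]

theorem contraction_linearForm_zero_perazzoForm (a : ι → K) (P : ι → DP K (Fin m))
    (G : DP K (Fin m)) :
    contraction K _ (linearForm a (0 : Fin m → K)) (perazzoForm P G) =
      inclY ι (∑ i, a i • P i) := by
  simp only [linearForm, Pi.zero_apply, map_zero, zero_mul, Finset.sum_const_zero, add_zero,
    map_sum, LinearMap.sum_apply, contraction_mul, contraction_X_inl_perazzoForm, contraction_C,
    ← inclYHom_apply, map_smul]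

theorem contraction_linearForm_zero_inclY (a : ι → K) (G : DP K (Fin m)) :
    contraction K _ (linearForm a (0 : Fin m → K)) (inclY ι G) = 0 := by
  simp only [linearForm, Pi.zero_apply, map_zero, zero_mul, Finset.sum_const_zero, add_zero,
    map_sum, LinearMap.sum_apply, contraction_mul, contraction_X_inl_inclY]

theorem contraction_linearForm_perazzoForm (a : ι → K) (b : Fin m → K) (P : ι → DP K (Fin m))
    (G : DP K (Fin m)) :
    contraction K _ (linearForm a b) (perazzoForm P G) =
      perazzoForm (fun i => contraction K _ (yForm b) (P i))
        (contraction K _ (yForm b) G + ∑ i, a i • P i) := by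
  rw [linearForm_eq, map_add, LinearMap.add_apply, contraction_linearForm_zero_perazzoForm,
    contraction_rename_perazzoForm, add_comm, perazzoForm_add_inclY]

/-- `F` is of degree one in the `X_k`, so the square of the `x`-part of `ℓ` kills it, and only two
terms of the binomial expansion survive. At `i = 0` the truncated exponent `i - 1` carries the
coefficient `0`. -/
theorem contraction_linearForm_pow_perazzoForm (a : ι → K) (b : Fin m → K)
    (P : ι → DP K (Fin m)) (G : DP K (Fin m)) (i : ℕ) :
    contraction K _ (linearForm a b ^ i) (perazzoForm P G) =
      perazzoForm (fun k => contraction K _ (yForm b ^ i) (P k))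
        (contraction K _ (yForm b ^ i) G +
          i • contraction K _ (yForm b ^ (i - 1)) (∑ k, a k • P k)) := by
  induction i with
  | zero => simp
  | succ i ih =>
    rw [pow_succ', contraction_mul, ih, contraction_linearForm_perazzoForm]
    congr 1
    · ext1 k
      rw [← contraction_mul, ← pow_succ']
    · have h : ∑ k, a k • contraction K (Fin m) (yForm b ^ i) (P k) =
          contraction K _ (yForm b ^ i) (∑ k, a k • P k) := by
        simp only [map_sum, map_smul]
      rw [h, map_add, ← contraction_mul, ← pow_succ', map_nsmul, ← contraction_mul, ← pow_succ',
        succ_nsmul, add_assoc, Nat.add_sub_cancel]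
      rcases i with _ | i
      · simp
      · rfl

end LinearForms

/-! ### Jordan types on full Perazzo algebras -/

section FullPerazzoForms

variable {K : Type*} [Field K] {ι : Type*} [Fintype ι] {m d : ℕ}
  {P : ι → DP K (Fin m)} {G : DP K (Fin m)}

theorem IsFullPerazzo.sum_mem (hP : IsFullPerazzo d P G) (a : ι → K) :
    ∑ k, a k • P k ∈ DP.homogeneous K (Fin m) (d - 1) := by
  rw [← hP.span_eq]
  exact Submodule.sum_mem _ fun k _ => Submodule.smul_mem _ _ (Submodule.subset_span ⟨k, rfl⟩)

theorem IsFullPerazzo.exists_sum_eq (hP : IsFullPerazzo d P G) {Q : DP K (Fin m)}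
    (hQ : Q ∈ DP.homogeneous K (Fin m) (d - 1)) : ∃ a : ι → K, ∑ k, a k • P k = Q := by
  rw [← hP.span_eq] at hQ
  exact (Submodule.mem_span_range_iff_exists_fun K).1 hQ

theorem IsFullPerazzo.sum_ne_zero (hP : IsFullPerazzo d P G) {a : ι → K} (ha : a ≠ 0) :
    ∑ k, a k • P k ≠ 0 := fun h =>
  ha (funext (Fintype.linearIndependent_iff.1 hP.linearIndependent a h))

theorem IsFullPerazzo.mem_degreeLE (hP : IsFullPerazzo d P G) (hd : 1 ≤ d) :
    perazzoForm P G ∈ DP.degreeLE K (ι ⊕ Fin m) d := by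
  obtain ⟨e, rfl⟩ := Nat.exists_eq_add_of_le' hd
  refine perazzoForm_mem_degreeLE (fun i => DP.homogeneous_le_degreeLE le_rfl ?_)
    (DP.homogeneous_le_degreeLE le_rfl hP.homogeneous)
  exact hP.span_eq ▸ Submodule.subset_span ⟨i, rfl⟩

theorem IsFullPerazzo.finrank_orbit (hP : IsFullPerazzo d P G) (hm : 1 ≤ m) (hd : 1 ≤ d) :
    Module.finrank K (orbit (perazzoForm P G)) = 2 * numMonomialsLT m d := by
  obtain ⟨e, rfl⟩ := Nat.exists_eq_add_of_le' hd
  exact finrank_orbit_perazzoForm hm hP.span_eq hP.homogeneous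

theorem IsFullPerazzo.finrank_alg (hP : IsFullPerazzo d P G) (hm : 1 ≤ m) (hd : 1 ≤ d) :
    Module.finrank K (Alg (perazzoForm P G)) = 2 * numMonomialsLT m d := by
  rw [FullPerazzo.finrank_alg, hP.finrank_orbit hm hd]

/-- The type of a linear form in the `x_i` alone. -/
theorem IsFullPerazzo.isJordanTypeOf_typeTwoOne (hP : IsFullPerazzo d P G) (hm : 1 ≤ m)
    (hd : 1 ≤ d) (a : ι → K) :
    IsJordanTypeOf (perazzoForm P G) (linearForm a (0 : Fin m → K))
      (typeTwoOne (2 * numMonomialsLT m d) (Module.finrank K (orbit (∑ k, a k • P k)))) := by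
  have hle := finrank_orbit_le_aMax hm (hP.sum_mem a)
  rw [Nat.sub_add_cancel hd] at hle
  have hle' := aMax_le_numMonomialsLT m d
  refine isJordanTypeOf_of_finrank (hP.mem_degreeLE hd) (pos_of_mem_typeTwoOne _ _) fun i => ?_
  rw [sum_map_sub_typeTwoOne (by omega)]
  rcases i with _ | _ | i
  · rw [pow_zero, map_one, Module.End.one_apply, hP.finrank_orbit hm hd, if_pos rfl]
  · rw [zero_add, pow_one, contraction_linearForm_zero_perazzoForm, finrank_orbit_inclY]
    simp
  · rw [pow_succ, contraction_mul, contraction_linearForm_zero_perazzoForm, pow_succ,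
      contraction_mul, contraction_linearForm_zero_inclY, map_zero, orbit_zero, finrank_bot]
    simp

/-- The part of `l^i ∘ F` not involving the `X_i`, for `l = ∑ a_i x_i + ∑ b_j y_j`. -/
def residualForm (P : ι → DP K (Fin m)) (G : DP K (Fin m)) (a : ι → K) (b : Fin m → K) (i : ℕ) :
    DP K (Fin m) :=
  contraction K _ (yForm b ^ i) G + i • contraction K _ (yForm b ^ (i - 1)) (∑ k, a k • P k)

theorem IsFullPerazzo.residualForm_mem (hP : IsFullPerazzo d P G) (a : ι → K) (b : Fin m → K)
    {i : ℕ} (hi : i ≤ d) : residualForm P G a b i ∈ DP.homogeneous K (Fin m) (d - i) := by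
  refine add_mem (contraction_mem_homogeneous (isHomogeneous_yForm_pow b i) ?_) ?_
  · rw [Nat.sub_add_cancel hi]
    exact hP.homogeneous
  · rcases i with _ | i
    · rw [zero_smul]
      exact zero_mem _
    · refine Submodule.smul_of_tower_mem _ _
        (contraction_mem_homogeneous (isHomogeneous_yForm_pow b _) ?_)
      rw [Nat.add_sub_cancel, show d - (i + 1) + i = d - 1 by omega]
      exact hP.sum_mem a

theorem IsFullPerazzo.residualForm_eq_zero (hP : IsFullPerazzo d P G) (a : ι → K)
    (b : Fin m → K) (hd : 1 ≤ d) {i : ℕ} (hi : d < i) : residualForm P G a b i = 0 := by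
  rw [residualForm, contraction_eq_zero_of_lt (isHomogeneous_yForm_pow b i) hP.homogeneous hi,
    contraction_eq_zero_of_lt (isHomogeneous_yForm_pow b _) (hP.sum_mem a) (by omega), smul_zero,
    add_zero]

theorem aMax_one (m : ℕ) : aMax m 1 = 1 := by
  rw [aMax_eq_sum]
  simp [numMonomials_zero]

-- For `i < d`, surjectivity of contraction by `y^i` keeps the coefficients spanning, so the
-- dimension does not depend on `a`, `b` or `G`. From `i = d` on the `X`-part is gone, and at `i =
-- d` the residual form is a constant.
open Classical in
theorem IsFullPerazzo.finrank_orbit_linearForm_pow (hP : IsFullPerazzo d P G) (hm : 1 ≤ m)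
    (hd : 1 ≤ d) (a : ι → K) {b : Fin m → K} (hb : b ≠ 0) (i : ℕ) :
    Module.finrank K (orbit (contraction K _ (linearForm a b ^ i) (perazzoForm P G))) =
      2 * numMonomialsLT m (d - i) + if i = d ∧ residualForm P G a b d ≠ 0 then 1 else 0 := by
  rw [contraction_linearForm_pow_perazzoForm]
  change Module.finrank K (orbit (perazzoForm _ (residualForm P G a b i))) = _
  rcases lt_or_ge i d with hi | hi
  · obtain ⟨e, rfl⟩ : ∃ e, d = e + 1 + i := ⟨d - 1 - i, by omega⟩
    rw [if_neg (by omega), add_zero, Nat.add_sub_cancel]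
    refine finrank_orbit_perazzoForm hm ?_ ?_
    · rw [← map_contraction_homogeneous (isHomogeneous_yForm_pow b i)
        (pow_ne_zero _ (yForm_ne_zero hb)), show e + i = e + 1 + i - 1 by omega, ← hP.span_eq,
        Submodule.map_span, ← Set.range_comp]
      rfl
    · simpa using hP.residualForm_mem a b hi.le
  · have h0 : (fun k => contraction K _ (yForm b ^ i) (P k)) = 0 := funext fun k =>
      contraction_eq_zero_of_lt (isHomogeneous_yForm_pow b i)
        (n := d - 1) (by rw [← hP.span_eq]; exact Submodule.subset_span ⟨k, rfl⟩) (by omega)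
    rw [h0, perazzoForm_zero_left, finrank_orbit_inclY, Nat.sub_eq_zero_of_le hi]
    rcases hi.eq_or_lt with rfl | hi
    · have hmem := hP.residualForm_mem a b le_rfl
      rw [Nat.sub_self] at hmem
      by_cases hc : residualForm P G a b d = 0
      · rw [finrank_orbit_of_eq_zero hc]
        simp [hc, numMonomialsLT]
      -- A nonzero constant has orbit of dimension exactly one, by the bounds for degree `0`.
      · have h1 := lt_finrank_orbit hmem hc
        have h2 := finrank_orbit_le_aMax hm hmem
        rw [zero_add, aMax_one] at h2
        simp only [hc, ne_eq, not_false_eq_true, and_self, if_true, numMonomialsLT,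
          Finset.range_zero, Finset.sum_empty]
        omega
    · rw [hP.residualForm_eq_zero a b hd hi, orbit_zero, finrank_bot, if_neg (by omega)]
      simp [numMonomialsLT]

theorem IsFullPerazzo.isJordanTypeOf_typeMiddle (hP : IsFullPerazzo d P G) (hm : 2 ≤ m)
    (hd : 2 ≤ d) {a : ι → K} {b : Fin m → K} (hb : b ≠ 0) (h : residualForm P G a b d = 0) :
    IsJordanTypeOf (perazzoForm P G) (linearForm a b) (typeMiddle m d) := by
  refine isJordanTypeOf_of_finrank (hP.mem_degreeLE (by omega)) (pos_of_mem_typeMiddle hm hd)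
    fun i => ?_
  rw [hP.finrank_orbit_linearForm_pow (by omega) (by omega) a hb,
    sum_map_sub_typeMiddle hm (by omega)]
  simp [h]

theorem IsFullPerazzo.isJordanTypeOf_typeTop (hP : IsFullPerazzo d P G) (hm : 2 ≤ m)
    (hd : 2 ≤ d) {a : ι → K} {b : Fin m → K} (hb : b ≠ 0) (h : residualForm P G a b d ≠ 0) :
    IsJordanTypeOf (perazzoForm P G) (linearForm a b) (typeTop m d) := by
  refine isJordanTypeOf_of_finrank (hP.mem_degreeLE (by omega)) (pos_of_mem_typeTop hm hd)
    fun i => ?_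
  rw [hP.finrank_orbit_linearForm_pow (by omega) (by omega) a hb, sum_map_sub_typeTop hm hd]
  simp [h]

/-- For `ℓ` with `y`-part `y_s`, the constant is the coefficient of `Y_s^[d]` in `G` plus `d` times
that of `Y_s^[d-1]` in `∑ a_k P_k`. The latter is free, and `t` solves the equation; here `d` must
be invertible. -/
theorem IsFullPerazzo.exists_residualForm_eq (hP : IsFullPerazzo d P G) (hm : 1 ≤ m)
    (hdK : (d : K) ≠ 0) (c : K) : ∃ (a : ι → K) (b : Fin m → K), b ≠ 0 ∧
      residualForm P G a b d = Finsupp.single 0 c := by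
  let s : Fin m := ⟨0, hm⟩
  let t : K := (c - G (Finsupp.single s d)) / d
  obtain ⟨a, ha⟩ := hP.exists_sum_eq (Q := Finsupp.single (Finsupp.single s (d - 1)) t)
    (DP.single_mem_homogeneous (Finsupp.degree_single _ _) _)
  have hb : (Pi.single s 1 : Fin m → K) ≠ 0 := by simp
  refine ⟨a, Pi.single s 1, hb, ?_⟩
  have hmem := hP.residualForm_mem a (Pi.single s 1) le_rfl
  rw [Nat.sub_self] at hmem
  ext γ
  by_cases hγ : γ = 0
  · subst hγ
    have hy : yForm (Pi.single s 1 : Fin m → K) = X s := by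
      rw [yForm, Finset.sum_eq_single s]
      · simp
      · intro j _ hj
        simp [hj]
      · simp
    rw [residualForm, ha, hy, X_pow_eq_monomial, X_pow_eq_monomial, Finsupp.add_apply,
      Finsupp.smul_apply, contraction_monomial_apply, contraction_monomial_apply]
    simp only [zero_add, one_mul, Finsupp.single_eq_same, nsmul_eq_mul]
    simp only [t]
    field_simp
    ring
  · rw [Finsupp.single_eq_of_ne hγ]
    exact DP.mem_homogeneous.1 hmem γ fun h => hγ ((Finsupp.degree_eq_zero_iff γ).1 h)

theorem natCast_ne_zero_of_ringChar {K : Type*} [Field K] {d : ℕ} (hd : d ≠ 0)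
    (hchar : ringChar K = 0 ∨ d < ringChar K) : (d : K) ≠ 0 := by
  rw [Ne, ringChar.spec]
  intro h
  rcases hchar with h0 | h0
  · rw [h0, zero_dvd_iff] at h
    exact hd h
  · exact absurd (Nat.le_of_dvd (Nat.pos_of_ne_zero hd) h) (not_le.2 h0)

theorem IsFullPerazzo.exists_finrank_orbit_eq (hP : IsFullPerazzo d P G) {Q : DP K (Fin m)}
    (hd : 1 ≤ d) (hQ : Q ∈ DP.homogeneous K (Fin m) (d - 1)) {r : ℕ}
    (hr : Module.finrank K (orbit Q) = r) (hr0 : r ≠ 0) (hm : 1 ≤ m) : ∃ a : ι → K, a ≠ 0 ∧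
      IsJordanTypeOf (perazzoForm P G) (linearForm a (0 : Fin m → K))
        (typeTwoOne (2 * numMonomialsLT m d) r) := by
  obtain ⟨a, rfl⟩ := hP.exists_sum_eq hQ
  refine ⟨a, ?_, hr ▸ hP.isJordanTypeOf_typeTwoOne hm hd a⟩
  rintro rfl
  exact hr0 (hr.symm.trans (finrank_orbit_of_eq_zero (by simp)))

end FullPerazzoForms

end FullPerazzo

end

/-! ### The chain of Jordan types -/

open FullPerazzo in
theorem corollary3p4 {K : Type*} [Field K] [Infinite K] (m d : ℕ) (hm : 2 ≤ m) (hd : 3 ≤ d)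
    (hchar : ringChar K = 0 ∨ d < ringChar K)
    {ι : Type*} [Fintype ι] (P : ι → DP K (Fin m)) (G : DP K (Fin m))
    (hP : IsFullPerazzo d P G)
    (F : DP K (ι ⊕ Fin m)) (hF : F = perazzoForm P G)
    (N : ℕ) (hN : N = Module.finrank K (Alg F)) :
    -- nonzero linear forms in the `x_i` alone have type `(2^r, 1^(N-2r))`, `r = dim A_{l ∘ F}`
    (∀ a : ι → K, a ≠ 0 →
      ∃ r, r = Module.finrank K (Alg (contraction K _ (linearForm a (0 : Fin m → K)) F)) ∧
        d ≤ r ∧ r ≤ aMax m d ∧ IsJordanTypeOf F (linearForm a 0) (typeTwoOne N r)) ∧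
    -- all other linear forms have one of the two top types
    (∀ (a : ι → K) (b : Fin m → K), b ≠ 0 →
      IsJordanTypeOf F (linearForm a b) (typeMiddle m d) ∨
        IsJordanTypeOf F (linearForm a b) (typeTop m d)) ∧
    -- the named members of the chain occur
    (∃ a : ι → K, a ≠ 0 ∧ IsJordanTypeOf F (linearForm a 0) (typeTwoOne N d)) ∧
    (∃ a : ι → K, a ≠ 0 ∧ IsJordanTypeOf F (linearForm a 0) (typeTwoOne N (aMax m d))) ∧
    (∃ (a : ι → K) (b : Fin m → K), b ≠ 0 ∧
      IsJordanTypeOf F (linearForm a b) (typeMiddle m d)) ∧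
    (∃ (a : ι → K) (b : Fin m → K), b ≠ 0 ∧
      IsJordanTypeOf F (linearForm a b) (typeTop m d)) ∧
    -- the chain is strictly increasing in the dominance order
    d < aMax m d ∧ 2 * aMax m d ≤ N ∧
    (∀ r s, d ≤ r → r < s → s ≤ aMax m d → DomLT (typeTwoOne N r) (typeTwoOne N s)) ∧
    DomLT (typeTwoOne N (aMax m d)) (typeMiddle m d) ∧
    DomLT (typeMiddle m d) (typeTop m d) := by
  subst hF
  have hd1 : 1 ≤ d := by omega
  have hm1 : 1 ≤ m := by omega
  rw [hP.finrank_alg hm1 hd1] at hN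
  subst hN
  have hle := aMax_le_numMonomialsLT m d
  have hdK : (d : K) ≠ 0 := natCast_ne_zero_of_ringChar (by omega) hchar
  have hlt := lt_aMax m d hm hd
  have hcancel : d - 1 + 1 = d := Nat.sub_add_cancel hd1
  refine ⟨fun a ha => ⟨_, rfl, ?_⟩, fun a b hb => ?_, ?_, ?_, ?_, ?_, hlt, by omega,
    fun r s _ hrs hs => typeTwoOne_domLT hrs (by omega), ?_,
    typeMiddle_domLT_typeTop hm (by omega)⟩
  · rw [contraction_linearForm_zero_perazzoForm, finrank_alg, finrank_orbit_inclY]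
    have h1 := lt_finrank_orbit (hP.sum_mem a) (hP.sum_ne_zero ha)
    have h2 := finrank_orbit_le_aMax hm1 (hP.sum_mem a)
    rw [hcancel] at h2
    exact ⟨by omega, h2, hP.isJordanTypeOf_typeTwoOne hm1 hd1 a⟩
  · by_cases h : residualForm P G a b d = 0
    · exact Or.inl (hP.isJordanTypeOf_typeMiddle hm (by omega) hb h)
    · exact Or.inr (hP.isJordanTypeOf_typeTop hm (by omega) hb h)
  -- The minimum `d` is attained by a divided power of one variable.
  · have hQ : Finsupp.single (Finsupp.single (⟨0, hm1⟩ : Fin m) (d - 1)) (1 : K) ∈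
        DP.homogeneous K (Fin m) (d - 1) :=
      DP.single_mem_homogeneous (Finsupp.degree_single _ _) _
    refine hP.exists_finrank_orbit_eq hd1 hQ ?_ (by omega) hm1
    have h1 := lt_finrank_orbit hQ (Finsupp.single_ne_zero.2 one_ne_zero)
    have h2 := finrank_orbit_single_le (K := K) (⟨0, hm1⟩ : Fin m) (d - 1)
    omega
  · obtain ⟨Q, hQ, hr⟩ := exists_compressed_form (K := K) hm1 (d - 1)
    rw [hcancel] at hr
    exact hP.exists_finrank_orbit_eq hd1 hQ hr (by omega) hm1
  · obtain ⟨a, b, hb, h⟩ := hP.exists_residualForm_eq hm1 hdK 0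
    exact ⟨a, b, hb, hP.isJordanTypeOf_typeMiddle hm (by omega) hb (by rw [h, Finsupp.single_zero])⟩
  · obtain ⟨a, b, hb, h⟩ := hP.exists_residualForm_eq hm1 hdK 1
    exact ⟨a, b, hb, hP.isJordanTypeOf_typeTop hm (by omega) hb
      (by rw [h]; exact Finsupp.single_ne_zero.2 one_ne_zero)⟩
  · refine typeTwoOne_domLT_of_sum_map_sub (by omega) ?_ (pos_of_mem_typeMiddle hm (by omega)) ?_
      ⟨d, ?_, hd⟩
    · rw [← sum_map_sub_zero, sum_map_sub_typeMiddle hm hd1, Nat.sub_zero]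
    · rw [sum_map_sub_typeMiddle hm hd1]
      exact aMax_le_two_mul_numMonomialsLT m d hd
    · rw [typeMiddle_eq hm (by omega)]
      exact Multiset.mem_cons_self _ _
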